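/- **Setting.** Let $\Gamma\subset\mathbb R^n\times\mathbb R^n\times\mathbb R$ be a domain (nonempty, open, connected) such that $I(x,y)=\{z:(x,y,z)\in\Gamma\}$ is a (possibly empty) open interval for all $x,y$, and let $g=g(x,y,z)\in C^2(\Gamma)$ with $g_z<0$. Put $J(x,y)=g(x,y,\cdot)(I(x,y))$ and $J(A,B)=\bigcap_{x\in A,\,y\in B}J(x,y)$; for $t\in J(x,y)$ let $g^*(x,y,t)$ be the unique $z\in I(x,y)$ with $g(x,y,z)=t$. Let $U,V\subset\mathbb R^n$ be domains with $U\times V\times g^*\big(U\times V\times J(U,V)\big)\subset\Gamma$, and let $\Omega,\Omega^*\subset\mathbb R^n$ be bounded domains with $\bar\Omega\subset U$, $\bar\Omega^*\subset V$. Let $d\in[0,\infty]$ be the diameter of $\Omega$ for the distance measured along curves in $\Omega$, i.e. the supremum over $x,x'\in\Omega$ of the infimum of the lengths of the curves in $\Omega$ from $x$ to $x'$ (so $d=\operatorname{diam}\Omega$ if $\Omega$ is convex). Assume: * **A1**: for each $x$ the map $(y,z)\mapsto (g_x,g)(x,y,z)$ is one-to-one on $\{(y,z):(x,y,z)\in\Gamma\}$;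 * **A2**: $\det\big(g_{x,y}-(g_z)^{-1}g_{x,z}\otimes g_y\big)\neq0$ in $\Gamma$; * **A1\***: for all $(y,z)$ the map $x\mapsto -(g_y/g_z)(x,y,z)$ is one-to-one on $\{x:(x,y,z)\in\Gamma\}$; * **A5**: there are $-\infty\le m_0<M_0\le\infty$ and $K_0>0$ such that $J_0=(m_0,M_0)\subset J(U,V)$, $2K_0d<M_0-m_0$ (no condition if $M_0-m_0=\infty$), and $|g_x(x,y,z)|\le K_0$ whenever $x\in\bar\Omega$, $y\in\bar\Omega^*$, $(x,y,z)\in\Gamma$ and $g(x,y,z)\in J_0$. A function $u\in C^0(\Omega)$ is *$g$-convex* in $\Omega$ if for each $x_0\in\Omega$ there are $y_0\in\mathbb R^n$ and $z_0\in\bigcap_{x\in\Omega}I(x,y_0)$ with $u(x_0)=g(x_0,y_0,z_0)$ and $u\ge g(\cdot,y_0,z_0)$ in $\Omega$. Its $g$-normal mapping $Tu(x_0)$ is the set of all $y_0\in\mathbb R^n$ with $u(x_0)\in J(x_0,y_0)$ such that, for $z_0=g^*(x_0,y_0,u(x_0))$, one has $(x,y_0,z_0)\in\Gamma$ and $u(x)\ge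 g(x,y_0,z_0)$ for all $x\in\Omega$; and $Tu(E)=\bigcup_{x\in E}Tu(x)$. Let $f\in L^1(\Omega)$, $f^*\in L^1(\Omega^*)$ be positive (a.e.) with $\int_\Omega f=\int_{\Omega^*}f^*$. A *generalized solution* of the second boundary value problem is a function $u\in C^0(\bar\Omega)$, $g$-convex in $\Omega$, such that for every Borel set $E\subset\Omega$ the set $Tu(E)\cap\Omega^*$ is Lebesgue measurable and $$\int_{Tu(E)\cap\Omega^*}f^*=\int_E f .$$ The domain $\Omega^*$ is *$g^*$-convex with respect to $u$* if for every $x\in\Omega$ one has $u(x)\in J(x,y)$ for all $y\in\Omega^*$ and the set $\{g_x(x,y,g^*(x,y,u(x))):y\in\Omega^*\}$ is convex. **Theorem 3.1.** Put $K_1=K_0d$ (with $m_0+K_1=-\infty$ if $m_0=-\infty$). 1. For any $x_0\in\Omega$ and any $u_0\in J(U,V)$ with $u_0>m_0+K_1$ there exists a generalized solution $u$ with $u(x_0)=u_0$. 2. If $u$ is any generalized solution such that $u(x)\in J(x,y)$ for all $x\in\Omega$, $y\in\bar\Omega^*$, and $\Omega^*$ is $g^*$-convex with respect to $u$, then $Tu(\Omega)\subset\bar\Omega^*$.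 -/

import Mathlib

open Set MeasureTheory
open scoped ENNReal

noncomputable section

namespace GJE

/-- Euclidean `n`-space. -/
abbrev Rn (n : ℕ) : Type := EuclideanSpace ℝ (Fin n)

variable {n : ℕ}

/-- A domain: a nonempty, open, connected subset of a topological space. -/
def IsDomainSet {X : Type*} [TopologicalSpace X] (S : Set X) : Prop :=
  IsOpen S ∧ IsConnected S

/-! ### The generating function `g(x, y, z)` and its first derivatives -/

/-- The gradient `g_x(x, y, z)`. -/
def gx (g : Rn n × Rn n × ℝ → ℝ) (x y : Rn n) (z : ℝ) : Rn n :=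
  gradient (fun x' => g (x', y, z)) x

/-- The gradient `g_y(x, y, z)`. -/
def gy (g : Rn n × Rn n × ℝ → ℝ) (x y : Rn n) (z : ℝ) : Rn n :=
  gradient (fun y' => g (x, y', z)) y

/-- The partial derivative `g_z(x, y, z)`. -/
def gz (g : Rn n × Rn n × ℝ → ℝ) (x y : Rn n) (z : ℝ) : ℝ :=
  deriv (fun z' => g (x, y, z')) z

/-- `I(x, y) = {z | (x, y, z) ∈ Γ}`. -/
def I (Γ : Set (Rn n × Rn n × ℝ)) (x y : Rn n) : Set ℝ := {z | (x, y, z) ∈ Γ}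

/-- `J(x, y) = g(x, y, ·)(I(x, y))`. -/
def J (Γ : Set (Rn n × Rn n × ℝ)) (g : Rn n × Rn n × ℝ → ℝ) (x y : Rn n) : Set ℝ :=
  (fun z => g (x, y, z)) '' I Γ x y

/-- `J(A, B)`, the intersection of the sets `J(x, y)` over `x ∈ A`, `y ∈ B`. -/
def JInter (Γ : Set (Rn n × Rn n × ℝ)) (g : Rn n × Rn n × ℝ → ℝ) (A B : Set (Rn n)) : Set ℝ :=
  ⋂ x ∈ A, ⋂ y ∈ B, J Γ g x y

/-- `g` is a `C²` generating function on the domain `Γ`, whose fibres `I(x, y)` are (possibly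
empty) open intervals, normalised by `g_z < 0`. -/
structure IsGeneratingFunction (Γ : Set (Rn n × Rn n × ℝ)) (g : Rn n × Rn n × ℝ → ℝ) : Prop where
  domain : IsDomainSet Γ
  interval : ∀ x y, (I Γ x y).OrdConnected
  contDiffOn : ContDiffOn ℝ 2 g Γ
  gz_neg : ∀ x y z, (x, y, z) ∈ Γ → gz g x y z < 0

/-- The dual generating function `g*`: for `t ∈ J(x, y)`, `g*(x, y, t)` is the
`z ∈ I(x, y)` with `g(x, y, z) = t`. (No meaning is attached to it for `t ∉ J(x, y)`.) -/
def gstar (Γ : Set (Rn n × Rn n × ℝ)) (g : Rn n × Rn n × ℝ → ℝ) (x y : Rn n) (t : ℝ) : ℝ :=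
  Function.invFunOn (fun z => g (x, y, z)) (I Γ x y) t

/-- `Q = - g_y / g_z`. -/
def Q (g : Rn n × Rn n × ℝ → ℝ) (x y : Rn n) (z : ℝ) : Rn n :=
  -((gz g x y z)⁻¹ • gy g x y z)

/-- `P(x, y, t) = g_x(x, y, g*(x, y, t))`. -/
def P (Γ : Set (Rn n × Rn n × ℝ)) (g : Rn n × Rn n × ℝ → ℝ) (x y : Rn n) (t : ℝ) : Rn n :=
  gx g x y (gstar Γ g x y t)

/-- The matrix `E = g_{x,y} - (g_z)⁻¹ g_{x,z} ⊗ g_y`. -/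
def EMatrix (g : Rn n × Rn n × ℝ → ℝ) (x y : Rn n) (z : ℝ) : Matrix (Fin n) (Fin n) ℝ :=
  Matrix.of fun i j =>
    (fderiv ℝ (fun y' => gx g x y' z) y (EuclideanSpace.single j 1)) i
      - (gz g x y z)⁻¹ * ((deriv (fun z' => gx g x y z') z) i * (gy g x y z) j)

/-! ### Conditions on the generating function -/

/-- Condition A1: `(g_x, g)(x, ·, ·)` is one-to-one in `Γ_x`, for each `x`. -/
def A1 (Γ : Set (Rn n × Rn n × ℝ)) (g : Rn n × Rn n × ℝ → ℝ) : Prop :=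
  ∀ x : Rn n, InjOn (fun w : Rn n × ℝ => (gx g x w.1 w.2, g (x, w.1, w.2)))
    {w : Rn n × ℝ | (x, w.1, w.2) ∈ Γ}

/-- Condition A2: `det E ≠ 0` in `Γ`. -/
def A2 (Γ : Set (Rn n × Rn n × ℝ)) (g : Rn n × Rn n × ℝ → ℝ) : Prop :=
  ∀ x y z, (x, y, z) ∈ Γ → (EMatrix g x y z).det ≠ 0

/-- Condition A1*: `Q(·, y, z)` is one-to-one in `Γ_{y,z}`, for all `(y, z)`. -/
def A1star (Γ : Set (Rn n × Rn n × ℝ)) (g : Rn n × Rn n × ℝ → ℝ) : Prop :=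
  ∀ (y : Rn n) (z : ℝ), InjOn (fun x => Q g x y z) {x : Rn n | (x, y, z) ∈ Γ}

/-- The standing condition on the domains `U`, `V`:
`U × V × g*(U × V × J(U, V)) ⊆ Γ`. -/
def IsAdmissiblePair (Γ : Set (Rn n × Rn n × ℝ)) (g : Rn n × Rn n × ℝ → ℝ)
    (U V : Set (Rn n)) : Prop :=
  IsDomainSet U ∧ IsDomainSet V ∧
    ∀ x ∈ U, ∀ y ∈ V, ∀ x' ∈ U, ∀ y' ∈ V, ∀ t ∈ JInter Γ g U V, (x, y, gstar Γ g x' y' t) ∈ Γ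

/-- Infimum of the lengths of the curves in `Ω` from `x` to `x'`. -/
def pathDist (Ω : Set (Rn n)) (x x' : Rn n) : ℝ≥0∞ :=
  ⨅ (γ : ℝ → Rn n) (_ : ContinuousOn γ (Icc 0 1) ∧ MapsTo γ (Icc 0 1) Ω ∧ γ 0 = x ∧ γ 1 = x'),
    eVariationOn γ (Icc 0 1)

/-- The diameter of `Ω`, distances being measured along curves in `Ω`. -/
def diamIn (Ω : Set (Rn n)) : ℝ≥0∞ := ⨆ x ∈ Ω, ⨆ x' ∈ Ω, pathDist Ω x x'

/-- The distance along curves is at least the Euclidean distance. -/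
theorem edist_le_pathDist (Ω : Set (Rn n)) (x x' : Rn n) : edist x x' ≤ pathDist Ω x x' := by
  refine le_iInf₂ fun γ hγ => ?_
  obtain ⟨-, -, rfl, rfl⟩ := hγ
  exact eVariationOn.edist_le γ (by simp) (by simp)

/-- In a convex set the distance along curves is the Euclidean distance. -/
theorem pathDist_of_convex {Ω : Set (Rn n)} (hΩ : Convex ℝ Ω) {x x' : Rn n} (hx : x ∈ Ω)
    (hx' : x' ∈ Ω) : pathDist Ω x x' = edist x x' := by
  refine le_antisymm ?_ (edist_le_pathDist Ω x x')
  refine (iInf₂_le (fun t => AffineMap.lineMap x x' t)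
    ⟨by fun_prop, fun t ht => hΩ.lineMap_mem hx hx' ht, by simp, by simp⟩).trans ?_
  have hL : LipschitzOnWith (nndist x x') (fun t : ℝ => AffineMap.lineMap x x' t) (Icc 0 1) :=
    (lipschitzWith_lineMap x x').lipschitzOnWith
  have h := hL.comp_eVariationOn_le (g := (id : ℝ → ℝ)) (s := Icc 0 1) (mapsTo_id _)
  rw [eVariationOn_id_Icc] at h
  rw [sub_zero, ENNReal.ofReal_one, mul_one, ← edist_nndist] at h
  exact h

/-- For convex `Ω`, `diamIn Ω` is the usual diameter. -/
theorem diamIn_of_convex {Ω : Set (Rn n)} (hΩ : Convex ℝ Ω) : diamIn Ω = Metric.ediam Ω := by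
  unfold diamIn Metric.ediam
  exact iSup_congr fun x => iSup_congr fun hx => iSup_congr fun x' => iSup_congr fun hx' =>
    pathDist_of_convex hΩ hx hx'

/-- The open interval `(m₀, M₀)` of real numbers, `-∞ ≤ m₀`, `M₀ ≤ ∞`. -/
def J0 (m₀ M₀ : EReal) : Set ℝ := {t : ℝ | m₀ < (t : EReal) ∧ (t : EReal) < M₀}

/-- `K₁ = K₀ d`, with `d` the diameter of `Ω` along curves. -/
def K1 (K₀ : ℝ) (Ω : Set (Rn n)) : EReal := (K₀ : EReal) * (diamIn Ω : EReal)

/-- Condition A5. The condition `K₀ < (M₀ - m₀) / 2d` is read as void if `M₀ - m₀ = ∞`. -/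
structure A5 (Γ : Set (Rn n × Rn n × ℝ)) (g : Rn n × Rn n × ℝ → ℝ) (U V Ω Ωs : Set (Rn n))
    (m₀ M₀ : EReal) (K₀ : ℝ) : Prop where
  lt : m₀ < M₀
  subset : J0 m₀ M₀ ⊆ JInter Γ g U V
  pos : 0 < K₀
  small : M₀ - m₀ ≠ ⊤ → 2 * K1 K₀ Ω < M₀ - m₀
  bound : ∀ x ∈ closure Ω, ∀ y ∈ closure Ωs, ∀ z, (x, y, z) ∈ Γ → g (x, y, z) ∈ J0 m₀ M₀ →
    ‖gx g x y z‖ ≤ K₀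

/-! ### `g`-convexity, normal mapping and generalized solutions -/

/-- `u ∈ C⁰(Ω)` is `g`-convex in `Ω`. -/
def IsGConvex (Γ : Set (Rn n × Rn n × ℝ)) (g : Rn n × Rn n × ℝ → ℝ) (Ω : Set (Rn n))
    (u : Rn n → ℝ) : Prop :=
  ContinuousOn u Ω ∧ ∀ x₀ ∈ Ω, ∃ y₀ : Rn n, ∃ z₀ ∈ ⋂ x ∈ Ω, I Γ x y₀,
    u x₀ = g (x₀, y₀, z₀) ∧ ∀ x ∈ Ω, g (x, y₀, z₀) ≤ u x

/-- The `g`-normal mapping `Tu(x₀)` of `u` on `Ω`: all `y₀` such that, with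
`z₀ = g*(x₀, y₀, u(x₀))`, `Ω ⊆ Γ_{y₀,z₀}` and `u ≥ g(·, y₀, z₀)` in `Ω`. -/
def normalMap (Γ : Set (Rn n × Rn n × ℝ)) (g : Rn n × Rn n × ℝ → ℝ) (Ω : Set (Rn n))
    (u : Rn n → ℝ) (x₀ : Rn n) : Set (Rn n) :=
  {y₀ | u x₀ ∈ J Γ g x₀ y₀ ∧
    ∀ x ∈ Ω, (x, y₀, gstar Γ g x₀ y₀ (u x₀)) ∈ Γ ∧ g (x, y₀, gstar Γ g x₀ y₀ (u x₀)) ≤ u x}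

/-- The image `Tu(A) = ⋃_{x ∈ A} Tu(x)`. -/
def normalImage (Γ : Set (Rn n × Rn n × ℝ)) (g : Rn n × Rn n × ℝ → ℝ) (Ω : Set (Rn n))
    (u : Rn n → ℝ) (A : Set (Rn n)) : Set (Rn n) :=
  ⋃ x ∈ A, normalMap Γ g Ω u x

/-- Generalized solutions of the second boundary value problem with densities `f` on `Ω` and
`f*` on `Ω*`: a function `u ∈ C⁰(closure Ω)`, `g`-convex in `Ω`, with
`∫_{Tu(A)} f* = ∫_A f` for all Borel `A ⊆ Ω`, where `f*` is extended to vanish outside `Ω*`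
(so that only `Tu(A) ∩ Ω*` counts, which has to be Lebesgue measurable). -/
structure IsGeneralizedSolution (Γ : Set (Rn n × Rn n × ℝ)) (g : Rn n × Rn n × ℝ → ℝ)
    (Ω Ωs : Set (Rn n)) (f fs : Rn n → ℝ) (u : Rn n → ℝ) : Prop where
  continuousOn : ContinuousOn u (closure Ω)
  gConvex : IsGConvex Γ g Ω u
  measure_eq : ∀ A : Set (Rn n), MeasurableSet A → A ⊆ Ω →
    NullMeasurableSet (normalImage Γ g Ω u A ∩ Ωs) volume ∧
      ∫ y in normalImage Γ g Ω u A ∩ Ωs, fs y = ∫ x in A, f x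

/-- `Ω*` is `g*`-convex with respect to `x₀` and `u₀ ∈ J(x₀, Ω*)`. -/
def IsGStarConvexAt (Γ : Set (Rn n × Rn n × ℝ)) (g : Rn n × Rn n × ℝ → ℝ) (Ωs : Set (Rn n))
    (x₀ : Rn n) (u₀ : ℝ) : Prop :=
  u₀ ∈ JInter Γ g {x₀} Ωs ∧ Convex ℝ ((fun y => P Γ g x₀ y u₀) '' Ωs)

/-- `Ω*` is `g*`-convex with respect to the function `u` on `Ω`, that is, with respect to each
point on the graph of `u`. -/
def IsGStarConvexWrt (Γ : Set (Rn n × Rn n × ℝ)) (g : Rn n × Rn n × ℝ → ℝ) (Ω Ωs : Set (Rn n))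
    (u : Rn n → ℝ) : Prop :=
  ∀ x ∈ Ω, IsGStarConvexAt Γ g Ωs x (u x)

end GJE

end

/-! Existence is a market equilibrium. Points of `Ω` are buyers, points of `Ωs` are goods, and `g
(x, y, z)` is the utility to `x` of the good `y` at price `z`. For `N` buyers and `N` goods an
ascending auction with increment `ε` ends in an approximate equilibrium
(`exists_approx_equilibrium`). Sampling the two normalized densities and letting `N → ∞`, `ε → 0`
yields a coupling carried by a compact set `S` of triples in which each buyer's pair `(y, z)` is
optimal (`exists_stable_plan`). The solution is the envelope `u x = max g (x, y, z)` over `S`;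
optimality puts `y` in `Tu(x)` for each triple of `S`.

The value at `x₀` is fixed by the reserve prices `g*(x₀, y, u₀)`: prices at or above them give `u x₀
≤ u₀`, and the last good to find a holder costs about its reserve price, which gives equality in the
limit. A5 enters through `A5.exists_level`: at reserve prices all utilities exceed a common level
`t`. The utility can then be truncated at `t`, so that auction prices stay bounded, and the
equilibrium does not feel the truncation.

For the mass balance, the price in `S` is a Lipschitz function `v` of `y`. If `y ∈ Ωs` lies in
`Tu(x)`, then `w ↦ g (x, w, v w)` is maximal at `y`, so `Dv(y) = Q(x, y, v y)` wherever `v` is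
differentiable, and A1* recovers `x`. By Rademacher's theorem almost every `y` comes from at most
one `x`, so the coupling matches the mass of `A` with that of `Tu(A)`.

For the second assertion, let `y₁ ∈ Tu(x₁)`. If `P(x₁, y₁, u x₁)` lay outside the compact convex set
of values of `P(x₁, ·, u x₁)` on `closure Ωs`, a vector `e` and a number `c` would separate them.
The support at `x₁` makes `u` grow by more than `c s` from `x₁` to `x₁ + s e`. Since `f > 0`, `u`
also has at `x₁ + s e` a support with parameter in `closure Ωs`, which allows a growth of less than
`c s`. Hence the value lies in the set, and A1 gives `y₁ ∈ closure Ωs`. -/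

/-! ### Finite markets: the ascending auction -/

/-- A state of the ascending auction in which the buyer `τ j` holds the good `j`, the good `j` costs
`a j + ε * k j`, goods without a holder are at their reserve price `a j`, and every holder prefers
his good, at the price before the last increment, to all goods at the current prices. -/
structure AuctionState {N : ℕ} (w : Fin N → Fin N → ℝ → ℝ) (a : Fin N → ℝ) (ε B : ℝ)
    (τ : Fin N → Option (Fin N)) (k : Fin N → ℕ) : Prop where
  inj : ∀ i j j', τ j = some i → τ j' = some i → j = j'
  free : ∀ j, τ j = none → k j = 0
  held : ∀ j i, τ j = some i → 0 < k j ∧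
    ∀ j', w i j' (a j' + ε * k j') ≤ w i j (a j + ε * k j - ε)
  bound : ∀ j, 0 < k j → a j + ε * k j ≤ B + ε

/-- A state with a free good can be continued by one bid. -/
theorem AuctionState.exists_next {N : ℕ} {w : Fin N → Fin N → ℝ → ℝ} {a : Fin N → ℝ} {ε B : ℝ}
    (hw : ∀ i j, Antitone (w i j)) (hε : 0 < ε)
    (hB : ∀ i j j' z, B ≤ z → w i j' z < w i j (a j))
    {τ : Fin N → Option (Fin N)} {k : Fin N → ℕ} (h : AuctionState w a ε B τ k)
    {j₀ : Fin N} (hj₀ : τ j₀ = none) :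
    ∃ (τ' : Fin N → Option (Fin N)) (j : Fin N),
      AuctionState w a ε B τ' (Function.update k j (k j + 1)) ∧
      ∀ j', τ' j' = none ↔ (τ j' = none ∧ j' ≠ j) := by
  classical
  -- A free good leaves some buyer without a good: otherwise choosing a good for each buyer is
  -- injective, hence onto, and `j₀` is held.
  obtain ⟨i, hi⟩ : ∃ i, ∀ j, τ j ≠ some i := by
    by_contra! hcon
    choose s hs using hcon
    have hinj : Function.Injective s := fun i i' hii' => by
      have h1 := hs i
      rw [hii', hs i'] at h1
      exact (Option.some.inj h1).symm
    obtain ⟨i, hi⟩ := (Finite.injective_iff_surjective.1 hinj) j₀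
    have := hs i
    rw [hi, hj₀] at this
    cases this
  have : Nonempty (Fin N) := ⟨j₀⟩
  -- The idle buyer bids on his favourite good and displaces its holder, if any. A favourite priced
  -- at `B` or more would lose to the free good `j₀`, which is still at its reserve price.
  obtain ⟨j, hj⟩ := Finite.exists_max (fun j => w i j (a j + ε * k j))
  have hlt : a j + ε * k j < B := by
    by_contra! hcon
    have h1 := hB i j₀ j _ hcon
    have h2 := hj j₀
    simp only [h.free j₀ hj₀, Nat.cast_zero, mul_zero, add_zero] at h2
    linarith
  have hup : ∀ i' j', w i' j' (a j' + ε * (Function.update k j (k j + 1) j' : ℕ)) ≤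
      w i' j' (a j' + ε * k j') := by
    intro i' j'
    apply hw
    rcases eq_or_ne j' j with rfl | hne
    · simp only [Function.update_self, Nat.cast_add, Nat.cast_one]
      linarith
    · simp [hne]
  refine ⟨Function.update τ j (some i), j, ⟨?_, ?_, ?_, ?_⟩, ?_⟩
  · intro i' j₁ j₂ h₁ h₂
    by_cases e₁ : j₁ = j <;> by_cases e₂ : j₂ = j
    · rw [e₁, e₂]
    · subst e₁
      rw [Function.update_self] at h₁
      rw [Function.update_of_ne e₂, ← h₁] at h₂
      exact absurd h₂ (hi j₂)
    · subst e₂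
      rw [Function.update_self] at h₂
      rw [Function.update_of_ne e₁, ← h₂] at h₁
      exact absurd h₁ (hi j₁)
    · rw [Function.update_of_ne e₁] at h₁
      rw [Function.update_of_ne e₂] at h₂
      exact h.inj i' _ _ h₁ h₂
  · intro j' hj'
    have hne : j' ≠ j := by
      rintro rfl
      simp at hj'
    rw [Function.update_of_ne hne] at hj' ⊢
    exact h.free _ hj'
  · intro j' i' hj'
    rcases eq_or_ne j' j with rfl | hne
    · rw [Function.update_self] at hj'
      cases hj'
      refine ⟨by simp, fun j'' => (hup _ _).trans ((hj j'').trans ?_)⟩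
      apply le_of_eq
      congr 1
      simp only [Function.update_self, Nat.cast_add, Nat.cast_one]
      ring
    · rw [Function.update_of_ne hne] at hj'
      rw [Function.update_of_ne hne]
      exact ⟨(h.held _ _ hj').1, fun j'' => (hup _ _).trans ((h.held _ _ hj').2 j'')⟩
  · intro j' hj'
    rcases eq_or_ne j' j with rfl | hne
    · simp only [Function.update_self, Nat.cast_add, Nat.cast_one]
      linarith
    · rw [Function.update_of_ne hne] at hj' ⊢
      exact h.bound _ hj'
  · intro j'
    rcases eq_or_ne j' j with rfl | hne
    · simp
    · simp [hne]

/-- Every state with a free good leads to a state in which all goods are held and one of them has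
received a single bid. -/
theorem AuctionState.exists_complete {N : ℕ} {w : Fin N → Fin N → ℝ → ℝ} {a : Fin N → ℝ} {ε B : ℝ}
    (hw : ∀ i j, Antitone (w i j)) (hε : 0 < ε)
    (hB : ∀ i j j' z, B ≤ z → w i j' z < w i j (a j)) {M : ℕ} (hM : ∀ j, B + ε ≤ a j + ε * M) :
    ∀ (m : ℕ) (τ : Fin N → Option (Fin N)) (k : Fin N → ℕ), AuctionState w a ε B τ k →
      (∃ j, τ j = none) → N * M ≤ m + ∑ j, k j →
      ∃ (τ' : Fin N → Option (Fin N)) (k' : Fin N → ℕ), AuctionState w a ε B τ' k' ∧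
        (∀ j, τ' j ≠ none) ∧ ∃ j, k' j ≤ 1 := by
  -- Every bid raises `∑ j, k j` by one and the sum cannot exceed `N * M`, so `m` bounds the number
  -- of bids still possible.
  have key : ∀ (τ : Fin N → Option (Fin N)) (k : Fin N → ℕ), AuctionState w a ε B τ k →
      ∑ j, k j ≤ N * M := by
    intro τ k h
    have : ∀ j, k j ≤ M := by
      intro j
      rcases Nat.eq_zero_or_pos (k j) with h0 | h0
      · omega
      · have h1 := (h.bound j h0).trans (hM j)
        have h2 : ε * (k j : ℝ) ≤ ε * M := by linarith
        exact_mod_cast le_of_mul_le_mul_left h2 hε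
    calc ∑ j, k j ≤ ∑ _j : Fin N, M := Finset.sum_le_sum fun j _ => this j
      _ = N * M := by simp
  intro m
  induction m with
  | zero =>
    rintro τ k h ⟨j₀, hj₀⟩ hm
    obtain ⟨τ', j, h', -⟩ := h.exists_next hw hε hB hj₀
    have h1 := key _ _ h'
    have h2 := Finset.sum_update_of_mem (Finset.mem_univ j) k (k j + 1)
    have h3 := Finset.add_sum_erase Finset.univ k (Finset.mem_univ j)
    rw [← Finset.erase_eq] at h2
    omega
  | succ m ih =>
    rintro τ k h ⟨j₀, hj₀⟩ hm
    obtain ⟨τ', j, h', hτ'⟩ := h.exists_next hw hε hB hj₀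
    have h2 := Finset.sum_update_of_mem (Finset.mem_univ j) k (k j + 1)
    have h3 := Finset.add_sum_erase Finset.univ k (Finset.mem_univ j)
    rw [← Finset.erase_eq] at h2
    by_cases hfull : ∃ j, τ' j = none
    · exact ih _ _ h' hfull (by omega)
    · push Not at hfull
      refine ⟨τ', _, h', hfull, j, ?_⟩
      -- The bid that fills the market is the first one on the last free good.
      have hjn : j₀ = j := by
        by_contra hne
        exact hfull j₀ ((hτ' j₀).2 ⟨hj₀, hne⟩)
      subst hjn
      simp [h.free _ hj₀]

/-- Approximate competitive equilibrium of a market with `N` buyers and `N` goods, in which all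
prices are at least the reserve prices `a` and one of them is nearly a reserve price. -/
theorem exists_approx_equilibrium {N : ℕ} [NeZero N] {w : Fin N → Fin N → ℝ → ℝ} {a : Fin N → ℝ}
    {ε B : ℝ} (hw : ∀ i j, Antitone (w i j)) (hε : 0 < ε)
    (hB : ∀ i j j' z, B ≤ z → w i j' z < w i j (a j)) :
    ∃ (σ : Equiv.Perm (Fin N)) (z : Fin N → ℝ), (∀ j, a j ≤ z j) ∧ (∀ j, z j ≤ B + ε) ∧
      (∃ j, z j ≤ a j + ε) ∧ ∀ i j, w i j (z j) ≤ w i (σ i) (z (σ i) - ε) := by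
  obtain ⟨M, hM⟩ : ∃ M : ℕ, ∀ j, B + ε ≤ a j + ε * M := by
    have : ∀ j, ∃ M : ℕ, B + ε ≤ a j + ε * M := by
      intro j
      obtain ⟨M, hM⟩ := exists_nat_ge ((B + ε - a j) / ε)
      refine ⟨M, ?_⟩
      rw [div_le_iff₀ hε] at hM
      linarith
    choose M hM using this
    refine ⟨∑ j, M j, fun j => (hM j).trans ?_⟩
    have : M j ≤ ∑ j, M j := Finset.single_le_sum (f := M) (fun _ _ => Nat.zero_le _)
      (Finset.mem_univ j)
    gcongr
  obtain ⟨τ, k, h, hfull, j₁, hj₁⟩ := AuctionState.exists_complete hw hε hB hM (N * M)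
    (fun _ => none) (fun _ => 0) ⟨by simp, by simp, by simp, by simp⟩ ⟨0, rfl⟩ (by simp)
  have hs : ∀ j, ∃ i, τ j = some i := fun j => Option.ne_none_iff_exists'.1 (hfull j)
  choose s hs using hs
  have hinj : Function.Injective s := fun j j' hjj' =>
    h.inj (s j) j j' (hs j) (by rw [hs j', hjj'])
  let e : Equiv.Perm (Fin N) := Equiv.ofBijective s (Finite.injective_iff_bijective.1 hinj)
  refine ⟨e.symm, fun j => a j + ε * k j, fun j => ?_, fun j => ?_, ⟨j₁, ?_⟩, fun i j => ?_⟩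
  · have : 0 ≤ ε * k j := by positivity
    linarith
  · exact h.bound j (h.held j _ (hs j)).1
  · have : (k j₁ : ℝ) ≤ 1 := by exact_mod_cast hj₁
    nlinarith
  · refine (h.held (e.symm i) i ?_).2 j
    rw [hs]
    exact congrArg some (e.apply_symm_apply i)

/-! ### From finite markets to a stable coupling of two measures -/

section StablePlan

open Filter Topology TopologicalSpace ProbabilityTheory

/-- Finite measures on a compact metrizable space that agree on a dense sequence of continuous
functions are equal. -/
theorem measure_ext_of_integral_denseSeq {X : Type*} [TopologicalSpace X] [CompactSpace X]
    [MetrizableSpace X] [MeasurableSpace X] [BorelSpace X] {μ ν : Measure X} [IsFiniteMeasure μ]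
    [IsFiniteMeasure ν]
    (h : ∀ n, ∫ x, denseSeq C(X, ℝ) n x ∂μ = ∫ x, denseSeq C(X, ℝ) n x ∂ν) : μ = ν := by
  have hcont : ∀ (μ : Measure X) [IsFiniteMeasure μ], Continuous fun φ : C(X, ℝ) => ∫ x, φ x ∂μ := by
    intro μ _
    refine (continuous_integral.comp (ContinuousMap.toLp (E := ℝ) 1 μ ℝ).continuous).congr fun φ => ?_
    exact integral_congr_ae (ContinuousMap.coeFn_toLp μ φ)
  have key : (fun φ : C(X, ℝ) => ∫ x, φ x ∂μ) = fun φ : C(X, ℝ) => ∫ x, φ x ∂ν :=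
    (hcont μ).ext_on (denseRange_denseSeq C(X, ℝ)) (hcont ν) (by rintro _ ⟨n, rfl⟩; exact h n)
  exact ext_of_forall_integral_eq_of_IsFiniteMeasure fun f => congrFun key f.toContinuousMap

/-- Strong law of large numbers for a sequence of test functions. -/
theorem exists_seq_tendsto_average {X : Type*} [TopologicalSpace X] [CompactSpace X]
    [MeasurableSpace X] [BorelSpace X] (μ : Measure X) [IsProbabilityMeasure μ]
    (φ : ℕ → C(X, ℝ)) :
    ∃ x : ℕ → X, ∀ n, Tendsto (fun N : ℕ => (∑ i ∈ Finset.range N, φ n (x i)) / N) atTop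
      (𝓝 (∫ x, φ n x ∂μ)) := by
  have hae : ∀ n, ∀ᵐ ω ∂(Measure.infinitePi fun _ : ℕ => μ),
      Tendsto (fun N : ℕ => (∑ i ∈ Finset.range N, φ n (ω i)) / N) atTop
        (𝓝 (∫ x, φ n x ∂μ)) := by
    intro n
    have hmp := fun i => measurePreserving_eval_infinitePi (fun _ : ℕ => μ) i
    have hm : Measurable (φ n) := (φ n).continuous.measurable
    have hid : ∀ i, Measure.map (fun ω : ℕ → X => φ n (ω i)) (Measure.infinitePi fun _ : ℕ => μ) =
        Measure.map (φ n) μ := fun i => by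
      conv_rhs => rw [← (hmp i).map_eq, Measure.map_map hm (measurable_pi_apply i)]
      rfl
    have h := strong_law_ae_real (μ := Measure.infinitePi fun _ : ℕ => μ)
      (fun i ω => φ n (ω i)) ?_ ?_ ?_
    · have h0 : ∫ ω, φ n (ω 0) ∂(Measure.infinitePi fun _ : ℕ => μ) = ∫ x, φ n x ∂μ := by
        conv_rhs => rw [← (hmp 0).map_eq, integral_map (measurable_pi_apply 0).aemeasurable
          hm.aestronglyMeasurable]
      rwa [h0] at h
    · refine Integrable.of_bound (C := ‖φ n‖) (hm.comp (measurable_pi_apply 0)).aestronglyMeasurable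
        (ae_of_all _ fun ω => (φ n).norm_coe_le_norm _)
    · intro i j hij
      exact (iIndepFun_infinitePi (P := fun _ : ℕ => μ) (X := fun _ => φ n) fun _ => hm).indepFun hij
    · intro i
      exact ⟨(hm.comp (measurable_pi_apply i)).aemeasurable,
        (hm.comp (measurable_pi_apply 0)).aemeasurable, by rw [hid, hid]⟩
  exact (ae_all_iff.2 hae).exists

/-- The uniform measure on a finite family of points. -/
noncomputable def empiricalMeasure {E : Type*} [MeasurableSpace E] {N : ℕ} [NeZero N]
    (F : Fin N → E) : ProbabilityMeasure E :=
  ⟨(PMF.uniformOfFintype (Fin N)).toMeasure.map F,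
    Measure.isProbabilityMeasure_map (measurable_of_finite F).aemeasurable⟩

theorem integral_empiricalMeasure {E : Type*} [MeasurableSpace E] {N : ℕ} [NeZero N]
    (F : Fin N → E) {φ : E → ℝ} (hφ : StronglyMeasurable φ) :
    ∫ e, φ e ∂(empiricalMeasure F : Measure E) = (∑ i, φ (F i)) / N := by
  have h : (empiricalMeasure F : Measure E) = (PMF.uniformOfFintype (Fin N)).toMeasure.map F := rfl
  rw [h, integral_map (measurable_of_finite F).aemeasurable hφ.aestronglyMeasurable,
    PMF.integral_eq_sum, div_eq_inv_mul, Finset.mul_sum]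
  simp

theorem empiricalMeasure_eq_zero {E : Type*} [MeasurableSpace E] {N : ℕ} [NeZero N]
    (F : Fin N → E) {W : Set E} (hW : MeasurableSet W) (h : ∀ i, F i ∉ W) :
    (empiricalMeasure F : Measure E) W = 0 := by
  have h' : (empiricalMeasure F : Measure E) = (PMF.uniformOfFintype (Fin N)).toMeasure.map F := rfl
  rw [h', Measure.map_apply (measurable_of_finite F) hW]
  have : F ⁻¹' W = ∅ := eq_empty_of_forall_notMem h
  simp [this]

/-- The limit of a sequence of finite subsets of `E` along the ultrafilter `𝒰`. -/
def ultraLimit {E : Type*} [TopologicalSpace E] (𝒰 : Ultrafilter ℕ) (F : ∀ N : ℕ, Fin (N + 1) → E) :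
    Set E :=
  {p | ∀ W ∈ 𝓝 p, ∀ᶠ N in (𝒰 : Filter ℕ), ∃ i, F N i ∈ W}

theorem isClosed_ultraLimit {E : Type*} [TopologicalSpace E] (𝒰 : Ultrafilter ℕ)
    (F : ∀ N : ℕ, Fin (N + 1) → E) : IsClosed (ultraLimit 𝒰 F) := by
  refine isClosed_of_closure_subset fun p hp W hW => ?_
  obtain ⟨W', hW'W, hW'o, hpW'⟩ := mem_nhds_iff.1 hW
  obtain ⟨q, hqW, hq⟩ := mem_closure_iff.1 hp W' hW'o hpW'
  filter_upwards [hq W' (hW'o.mem_nhds hqW)] with N ⟨i, hi⟩ using ⟨i, hW'W hi⟩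

theorem mem_ultraLimit_of_tendsto {E : Type*} [TopologicalSpace E] {𝒰 : Ultrafilter ℕ}
    {F : ∀ N : ℕ, Fin (N + 1) → E} {p : E} (i : ∀ N, Fin (N + 1))
    (h : Tendsto (fun N => F N (i N)) 𝒰 (𝓝 p)) : p ∈ ultraLimit 𝒰 F := fun _ hW => by
  filter_upwards [h hW] with N hN using ⟨i N, hN⟩

/-- A point outside the limit set has an open neighbourhood which, for `𝒰`-most `N`, contains no
sample point. The portmanteau inequality for open sets makes it null, and second countability passes
from locally null to null. -/
theorem measure_compl_ultraLimit {E : Type*} [TopologicalSpace E] [SecondCountableTopology E]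
    [MeasurableSpace E] [OpensMeasurableSpace E] [HasOuterApproxClosed E] {𝒰 : Ultrafilter ℕ}
    {F : ∀ N : ℕ, Fin (N + 1) → E} {P : ProbabilityMeasure E}
    (h : Tendsto (fun N => empiricalMeasure (F N)) 𝒰 (𝓝 P)) :
    (P : Measure E) (ultraLimit 𝒰 F)ᶜ = 0 := by
  refine measure_null_of_locally_null _ fun p hp => ?_
  simp only [ultraLimit, mem_compl_iff, mem_ofPred_eq, not_forall] at hp
  obtain ⟨W, hW, hNW⟩ := hp
  obtain ⟨W', hW'W, hW'o, hpW'⟩ := mem_nhds_iff.1 hW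
  refine ⟨W', mem_nhdsWithin_of_mem_nhds (hW'o.mem_nhds hpW'), ?_⟩
  refine le_antisymm ((ProbabilityMeasure.le_liminf_measure_open_of_tendsto h hW'o).trans ?_) zero_le
  have hev : (fun N => (empiricalMeasure (F N) : Measure E) W') =ᶠ[𝒰] fun _ => 0 := by
    filter_upwards [Ultrafilter.eventually_not.2 hNW] with N hN
    exact empiricalMeasure_eq_zero _ hW'o.measurableSet fun i hi => hN ⟨i, hW'W hi⟩
  rw [liminf_congr hev, liminf_const]

/-- A stable plan: for a continuous utility `G (x, y, z)`, nonincreasing in the price `z`, and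
reserve prices `a`, there is a coupling of `μ` and `ν`, carried by a compact set of triples
`(x, y, z)` in which `(y, z)` is optimal for `x` among all pairs that occur, and in which some good
is sold at its reserve price. -/
theorem exists_stable_plan {X Y : Type*} [MetricSpace X] [CompactSpace X] [MeasurableSpace X]
    [BorelSpace X] [MetricSpace Y] [CompactSpace Y] [MeasurableSpace Y] [BorelSpace Y]
    (μ : Measure X) [IsProbabilityMeasure μ] (ν : Measure Y) [IsProbabilityMeasure ν]
    {G : X × Y × ℝ → ℝ} (hG : Continuous G) (hanti : ∀ x y, Antitone fun z => G (x, y, z))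
    {a : Y → ℝ} (ha : Continuous a) {B : ℝ}
    (hB : ∀ x y y' z, B ≤ z → G (x, y', z) < G (x, y, a y)) :
    ∃ (S : Set (X × Y × ℝ)) (P : Measure (X × Y × ℝ)), IsCompact S ∧ P Sᶜ = 0 ∧
      P.map (fun p => p.1) = μ ∧ P.map (fun p => p.2.1) = ν ∧ (∀ p ∈ S, a p.2.1 ≤ p.2.2) ∧
      (∃ p ∈ S, p.2.2 = a p.2.1) ∧ ∀ p ∈ S, ∀ q ∈ S, G (p.1, q.2) ≤ G p := by
  obtain ⟨lo, hlo⟩ : ∃ lo, ∀ y, lo ≤ a y := by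
    obtain ⟨lo, h⟩ := (isCompact_range ha).bddBelow
    exact ⟨lo, fun y => h ⟨y, rfl⟩⟩
  obtain ⟨x, hx⟩ := exists_seq_tendsto_average μ (denseSeq C(X, ℝ))
  obtain ⟨y, hy⟩ := exists_seq_tendsto_average ν (denseSeq C(Y, ℝ))
  have hεpos : ∀ N : ℕ, (0 : ℝ) < 1 / ((N : ℝ) + 1) := fun N => Nat.one_div_pos_of_nat
  have hεle : ∀ N : ℕ, 1 / ((N : ℝ) + 1) ≤ 1 := fun N => by
    rw [div_le_one (by positivity)]
    linarith [Nat.cast_nonneg (α := ℝ) N]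
  have heq : ∀ N : ℕ, ∃ (σ : Equiv.Perm (Fin (N + 1))) (z : Fin (N + 1) → ℝ),
      (∀ j : Fin (N + 1), a (y j) ≤ z j) ∧ (∀ j, z j ≤ B + 1 / ((N : ℝ) + 1)) ∧
      (∃ j : Fin (N + 1), z j ≤ a (y j) + 1 / ((N : ℝ) + 1)) ∧ ∀ i j : Fin (N + 1),
        G (x i, y j, z j) ≤ G (x i, y (σ i), z (σ i) - 1 / ((N : ℝ) + 1)) := fun N =>
    exists_approx_equilibrium (N := N + 1)
    (w := fun i j z => G (x i, y j, z)) (a := fun j => a (y j)) (fun i j => hanti _ _) (hεpos N)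
    (fun i j j' z hz => hB _ _ _ z hz)
  choose σ z hza hzB hj hopt using heq
  choose j₁ hj₁ using hj
  -- With prices in a fixed interval, `E` and its space of probability measures are compact, so
  -- limits along the ultrafilter exist.
  let E := X × Y × Icc lo (B + 1)
  let F : ∀ N : ℕ, Fin (N + 1) → E := fun N i => (x i, y (σ N i), ⟨z N (σ N i),
    (hlo _).trans (hza N _), (hzB N _).trans (by linarith [hεle N])⟩)
  let 𝒰 : Ultrafilter ℕ := hyperfilter ℕ
  have h𝒰 : (𝒰 : Filter ℕ) ≤ atTop := Nat.hyperfilter_le_atTop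
  obtain ⟨P, hP⟩ : ∃ P : ProbabilityMeasure E, Tendsto (fun N => empiricalMeasure (F N)) 𝒰 (𝓝 P) :=
    ⟨_, (𝒰.map fun N => empiricalMeasure (F N)).le_nhds_lim⟩
  have hint : ∀ φ : C(E, ℝ), Tendsto (fun N => (∑ i, φ (F N i)) / ((N + 1 : ℕ) : ℝ)) 𝒰
      (𝓝 (∫ e, φ e ∂(P : Measure E))) := by
    intro φ
    have h := ProbabilityMeasure.tendsto_iff_forall_integral_tendsto.1 hP
      (BoundedContinuousFunction.mkOfCompact φ)
    refine h.congr fun N => ?_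
    exact integral_empiricalMeasure _ φ.continuous.stronglyMeasurable
  have hshift : Tendsto (fun N : ℕ => N + 1) 𝒰 atTop := (tendsto_add_atTop_nat 1).mono_left h𝒰
  have hfst : (P : Measure E).map (fun e => e.1) = μ := by
    have := Measure.isProbabilityMeasure_map (μ := (P : Measure E)) (f := fun e : E => e.1)
      measurable_fst.aemeasurable
    refine measure_ext_of_integral_denseSeq fun n => ?_
    rw [integral_map measurable_fst.aemeasurable
      (denseSeq C(X, ℝ) n).continuous.aestronglyMeasurable]
    refine tendsto_nhds_unique (hint ((denseSeq C(X, ℝ) n).comp ⟨fun e : E => e.1, continuous_fst⟩))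
      (((hx n).comp hshift).congr fun N => ?_)
    simp only [Function.comp_apply, Finset.sum_range]
    rfl
  have hsnd : (P : Measure E).map (fun e => e.2.1) = ν := by
    have hm : Measurable fun e : E => e.2.1 := measurable_fst.comp measurable_snd
    have := Measure.isProbabilityMeasure_map (μ := (P : Measure E)) (f := fun e : E => e.2.1)
      hm.aemeasurable
    refine measure_ext_of_integral_denseSeq fun n => ?_
    rw [integral_map hm.aemeasurable (denseSeq C(Y, ℝ) n).continuous.aestronglyMeasurable]
    refine tendsto_nhds_unique (hint ((denseSeq C(Y, ℝ) n).comp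
      ⟨fun e : E => e.2.1, continuous_fst.comp continuous_snd⟩))
      (((hy n).comp hshift).congr fun N => ?_)
    simp only [Function.comp_apply, Finset.sum_range]
    -- The goods appear in the order given by `σ N`, which does not affect the sum.
    exact congrArg (· / _) (Equiv.sum_comp (σ N) fun i : Fin (N + 1) =>
      denseSeq C(Y, ℝ) n (y i)).symm
  have hstable : ∀ p ∈ ultraLimit 𝒰 F, ∀ q ∈ ultraLimit 𝒰 F,
      G (p.1, q.2.1, q.2.2) ≤ G (p.1, p.2.1, p.2.2) := by
    intro p hp q hq
    by_contra! hlt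
    -- The price increment is kept as a variable, so that a violation of stability at `(p, q)` with
    -- increment `0` is an open condition. It then occurs in some finite market, against `hopt`.
    let A : ((X × Y × Icc lo (B + 1)) × X × Y × Icc lo (B + 1)) × ℝ → ℝ := fun r =>
      G (r.1.1.1, r.1.1.2.1, (r.1.1.2.2 : ℝ) - r.2)
    let A' : ((X × Y × Icc lo (B + 1)) × X × Y × Icc lo (B + 1)) × ℝ → ℝ := fun r =>
      G (r.1.1.1, r.1.2.2.1, (r.1.2.2.2 : ℝ))
    have hA : Continuous A := hG.comp (by fun_prop)
    have hA' : Continuous A' := hG.comp (by fun_prop)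
    have hlt' : A ((p, q), 0) < A' ((p, q), 0) := by simpa [A, A'] using hlt
    have hev := hA.continuousAt.eventually_lt hA'.continuousAt hlt'
    rw [nhds_prod_eq, nhds_prod_eq] at hev
    obtain ⟨W, hW, V, hV, hWV⟩ := mem_prod_iff.1 hev
    obtain ⟨W₁, hW₁, W₂, hW₂, hWW⟩ := mem_prod_iff.1 hW
    have hε0 : Tendsto (fun N : ℕ => 1 / ((N : ℝ) + 1)) 𝒰 (𝓝 0) :=
      tendsto_one_div_add_atTop_nhds_zero_nat.mono_left h𝒰
    obtain ⟨N, ⟨i, hi⟩, ⟨j, hj⟩, hN⟩ := ((hp W₁ hW₁).and ((hq W₂ hW₂).and (hε0 hV))).exists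
    have hc : A ((F N i, F N j), 1 / ((N : ℝ) + 1)) < A' ((F N i, F N j), 1 / ((N : ℝ) + 1)) :=
      @hWV ((F N i, F N j), 1 / ((N : ℝ) + 1)) ⟨hWW ⟨hi, hj⟩, hN⟩
    exact absurd (hopt N i (σ N j)) (not_le.2 hc)
  have hge : ∀ p ∈ ultraLimit 𝒰 F, a p.2.1 ≤ p.2.2 := by
    intro p hp
    by_contra! hlt
    have hev : ∀ᶠ q : E in 𝓝 p, (q.2.2 : ℝ) < a q.2.1 :=
      ContinuousAt.eventually_lt (by fun_prop) (by fun_prop) hlt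
    obtain ⟨N, i, hi⟩ := (hp _ hev).exists
    exact absurd (hza N (σ N i)) (not_le.2 hi)
  -- Limit of the triples containing the good `j₁ N`, whose price is within one increment of its
  -- reserve price.
  obtain ⟨p, hp⟩ : ∃ p : E, Tendsto (fun N => F N ((σ N).symm (j₁ N))) 𝒰 (𝓝 p) :=
    ⟨_, (𝒰.map fun N => F N ((σ N).symm (j₁ N))).le_nhds_lim⟩
  have hpS := mem_ultraLimit_of_tendsto _ hp
  have hple : (p.2.2 : ℝ) ≤ a p.2.1 := by
    have h1 : Tendsto (fun N => ((F N ((σ N).symm (j₁ N))).2.2 : ℝ)) 𝒰 (𝓝 p.2.2) :=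
      ((by fun_prop : Continuous fun q : E => (q.2.2 : ℝ)).tendsto p).comp hp
    have h2 : Tendsto (fun N => a (F N ((σ N).symm (j₁ N))).2.1 + 1 / ((N : ℝ) + 1)) 𝒰
        (𝓝 (a p.2.1 + 0)) :=
      (((by fun_prop : Continuous fun q : E => a q.2.1).tendsto p).comp hp).add
        (tendsto_one_div_add_atTop_nhds_zero_nat.mono_left h𝒰)
    rw [add_zero] at h2
    refine le_of_tendsto_of_tendsto' h1 h2 fun N => ?_
    simpa [F] using hj₁ N
  let ι : E → X × Y × ℝ := fun e => (e.1, e.2.1, (e.2.2 : ℝ))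
  have hι : Continuous ι := by fun_prop
  have hcomp : IsCompact (ι '' ultraLimit 𝒰 F) := (isClosed_ultraLimit 𝒰 F).isCompact.image hι
  refine ⟨ι '' ultraLimit 𝒰 F, (P : Measure E).map ι, hcomp, ?_, ?_, ?_, ?_, ?_, ?_⟩
  · rw [Measure.map_apply hι.measurable hcomp.measurableSet.compl]
    refine measure_mono_null (fun e he => ?_) (measure_compl_ultraLimit hP)
    exact fun hmem => he ⟨e, hmem, rfl⟩
  · rw [Measure.map_map measurable_fst hι.measurable]
    exact hfst
  · exact (Measure.map_map (measurable_fst.comp measurable_snd) hι.measurable).trans hsnd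
  · rintro _ ⟨e, he, rfl⟩
    exact hge e he
  · exact ⟨_, ⟨p, hpS, rfl⟩, le_antisymm hple (hge p hpS)⟩
  · rintro _ ⟨e, he, rfl⟩ _ ⟨e', he', rfl⟩
    exact hstable e he e' he'

end StablePlan

namespace GJE

open Filter Topology

variable {n : ℕ} {Γ : Set (Rn n × Rn n × ℝ)} {g : Rn n × Rn n × ℝ → ℝ} {Ω Ωs : Set (Rn n)}
  {f fs u : Rn n → ℝ}

/-! ### Calculus of the generating function and its dual -/

namespace IsGeneratingFunction

theorem isOpen (hg : IsGeneratingFunction Γ g) : IsOpen Γ := hg.domain.1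

theorem contDiffAt (hg : IsGeneratingFunction Γ g) {p : Rn n × Rn n × ℝ} (hp : p ∈ Γ) :
    ContDiffAt ℝ 2 g p := hg.contDiffOn.contDiffAt (hg.isOpen.mem_nhds hp)

theorem continuousAt (hg : IsGeneratingFunction Γ g) {p : Rn n × Rn n × ℝ} (hp : p ∈ Γ) :
    ContinuousAt g p := (hg.contDiffAt hp).continuousAt

theorem continuousOn (hg : IsGeneratingFunction Γ g) : ContinuousOn g Γ := hg.contDiffOn.continuousOn

theorem hasFDerivAt (hg : IsGeneratingFunction Γ g) {p : Rn n × Rn n × ℝ} (hp : p ∈ Γ) :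
    HasFDerivAt g (fderiv ℝ g p) p :=
  ((hg.contDiffAt hp).differentiableAt two_ne_zero).hasFDerivAt

theorem continuousOn_fderiv (hg : IsGeneratingFunction Γ g) : ContinuousOn (fderiv ℝ g) Γ :=
  hg.contDiffOn.continuousOn_fderiv_of_isOpen hg.isOpen (by norm_num)

theorem hasFDerivAt_left (hg : IsGeneratingFunction Γ g) {x y : Rn n} {z : ℝ} (hp : (x, y, z) ∈ Γ) :
    HasFDerivAt (fun x' => g (x', y, z))
      (fderiv ℝ g (x, y, z) ∘L ContinuousLinearMap.inl ℝ (Rn n) (Rn n × ℝ)) x :=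
  (hg.hasFDerivAt hp).comp x (hasFDerivAt_prodMk_left x (y, z))

theorem gx_eq (hg : IsGeneratingFunction Γ g) {x y : Rn n} {z : ℝ} (hp : (x, y, z) ∈ Γ) :
    gx g x y z = (InnerProductSpace.toDual ℝ (Rn n)).symm
      (fderiv ℝ g (x, y, z) ∘L ContinuousLinearMap.inl ℝ (Rn n) (Rn n × ℝ)) := by
  rw [gx, gradient, (hg.hasFDerivAt_left hp).fderiv]

theorem inner_gx (hg : IsGeneratingFunction Γ g) {x y : Rn n} {z : ℝ} (hp : (x, y, z) ∈ Γ)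
    (e : Rn n) : inner ℝ (gx g x y z) e = fderiv ℝ g (x, y, z) (e, 0, 0) := by
  rw [hg.gx_eq hp, InnerProductSpace.toDual_symm_apply]
  rfl

theorem hasDerivAt_line (hg : IsGeneratingFunction Γ g) {x y e : Rn n} {s z : ℝ}
    (hp : (x + s • e, y, z) ∈ Γ) :
    HasDerivAt (fun s' : ℝ => g (x + s' • e, y, z)) (inner ℝ (gx g (x + s • e) y z) e) s := by
  have h : HasDerivAt (fun s' : ℝ => (x + s' • e, y, z)) (e, (0 : Rn n), (0 : ℝ)) s := by
    have h1 : HasDerivAt (fun s' : ℝ => x + s' • e) e s := by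
      simpa using ((hasDerivAt_id s).smul_const e).const_add x
    exact h1.prodMk ((hasDerivAt_const s y).prodMk (hasDerivAt_const s z))
  rw [hg.inner_gx hp]
  exact (hg.hasFDerivAt hp).comp_hasDerivAt s h

theorem gz_eq (hg : IsGeneratingFunction Γ g) {x y : Rn n} {z : ℝ} (hp : (x, y, z) ∈ Γ) :
    gz g x y z = fderiv ℝ g (x, y, z) (0, 0, 1) := by
  have h : HasDerivAt (fun z' : ℝ => (x, y, z')) ((0 : Rn n), (0 : Rn n), (1 : ℝ)) z :=
    (hasDerivAt_const z x).prodMk ((hasDerivAt_const z y).prodMk (hasDerivAt_id z))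
  exact ((hg.hasFDerivAt hp).comp_hasDerivAt z h).deriv

theorem inner_gy (hg : IsGeneratingFunction Γ g) {x y : Rn n} {z : ℝ} (hp : (x, y, z) ∈ Γ)
    (e : Rn n) : inner ℝ (gy g x y z) e = fderiv ℝ g (x, y, z) (0, e, 0) := by
  have h : HasFDerivAt (fun y' => g (x, y', z)) (fderiv ℝ g (x, y, z) ∘L
      (ContinuousLinearMap.inr ℝ (Rn n) (Rn n × ℝ) ∘L ContinuousLinearMap.inl ℝ (Rn n) ℝ)) y :=
    (hg.hasFDerivAt hp).comp y
      ((hasFDerivAt_prodMk_right x (y, z)).comp y (hasFDerivAt_prodMk_left y z))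
  rw [gy, gradient, h.fderiv, InnerProductSpace.toDual_symm_apply]
  rfl

theorem continuousOn_gx (hg : IsGeneratingFunction Γ g) :
    ContinuousOn (fun p : Rn n × Rn n × ℝ => gx g p.1 p.2.1 p.2.2) Γ := by
  have h : ContinuousOn (fun p => (InnerProductSpace.toDual ℝ (Rn n)).symm
      (fderiv ℝ g p ∘L ContinuousLinearMap.inl ℝ (Rn n) (Rn n × ℝ))) Γ :=
    (InnerProductSpace.toDual ℝ (Rn n)).symm.continuous.comp_continuousOn
      (hg.continuousOn_fderiv.clm_comp continuousOn_const)
  exact h.congr fun p hp => hg.gx_eq hp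

theorem isOpen_I (hg : IsGeneratingFunction Γ g) (x y : Rn n) : IsOpen (I Γ x y) :=
  hg.isOpen.preimage (by fun_prop : Continuous fun z : ℝ => (x, y, z))

theorem strictAntiOn (hg : IsGeneratingFunction Γ g) (x y : Rn n) :
    StrictAntiOn (fun z => g (x, y, z)) (I Γ x y) := by
  have hconv : Convex ℝ (I Γ x y) := (hg.interval x y).convex
  refine strictAntiOn_of_deriv_neg hconv (hg.continuousOn.comp (by fun_prop) fun z hz => hz) ?_
  intro z hz
  exact hg.gz_neg x y z (interior_subset hz : z ∈ I Γ x y)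

theorem ordConnected_J (hg : IsGeneratingFunction Γ g) (x y : Rn n) : (J Γ g x y).OrdConnected := by
  have h : IsPreconnected (J Γ g x y) := (hg.interval x y).isPreconnected.image _
    (hg.continuousOn.comp (by fun_prop) fun z hz => hz)
  exact h.ordConnected

theorem mem_J (x y : Rn n) {z : ℝ} (h : (x, y, z) ∈ Γ) : g (x, y, z) ∈ J Γ g x y := ⟨z, h, rfl⟩

theorem gstar_mem {x y : Rn n} {t : ℝ} (ht : t ∈ J Γ g x y) : (x, y, gstar Γ g x y t) ∈ Γ :=
  Function.invFunOn_mem (f := fun z => g (x, y, z)) ht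

theorem g_gstar {x y : Rn n} {t : ℝ} (ht : t ∈ J Γ g x y) : g (x, y, gstar Γ g x y t) = t :=
  Function.invFunOn_eq (f := fun z => g (x, y, z)) ht

theorem gstar_g (hg : IsGeneratingFunction Γ g) {x y : Rn n} {z : ℝ} (hz : (x, y, z) ∈ Γ) :
    gstar Γ g x y (g (x, y, z)) = z :=
  (hg.strictAntiOn x y).injOn (gstar_mem (mem_J x y hz)) hz (g_gstar (mem_J x y hz))

theorem g_le_iff (hg : IsGeneratingFunction Γ g) {x y : Rn n} {z z' : ℝ} (hz : (x, y, z) ∈ Γ)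
    (hz' : (x, y, z') ∈ Γ) : g (x, y, z) ≤ g (x, y, z') ↔ z' ≤ z :=
  (hg.strictAntiOn x y).le_iff_ge hz hz'

theorem g_lt_iff (hg : IsGeneratingFunction Γ g) {x y : Rn n} {z z' : ℝ} (hz : (x, y, z) ∈ Γ)
    (hz' : (x, y, z') ∈ Γ) : g (x, y, z) < g (x, y, z') ↔ z' < z :=
  (hg.strictAntiOn x y).lt_iff_gt hz hz'

theorem gstar_le_iff (hg : IsGeneratingFunction Γ g) {x y : Rn n} {z t : ℝ} (hz : (x, y, z) ∈ Γ)
    (ht : t ∈ J Γ g x y) : gstar Γ g x y t ≤ z ↔ g (x, y, z) ≤ t := by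
  rw [← hg.g_le_iff hz (gstar_mem ht), g_gstar ht]

theorem le_gstar_iff (hg : IsGeneratingFunction Γ g) {x y : Rn n} {z t : ℝ} (hz : (x, y, z) ∈ Γ)
    (ht : t ∈ J Γ g x y) : z ≤ gstar Γ g x y t ↔ t ≤ g (x, y, z) := by
  rw [← hg.g_le_iff (gstar_mem ht) hz, g_gstar ht]

theorem lt_gstar_iff (hg : IsGeneratingFunction Γ g) {x y : Rn n} {z t : ℝ} (hz : (x, y, z) ∈ Γ)
    (ht : t ∈ J Γ g x y) : z < gstar Γ g x y t ↔ t < g (x, y, z) := by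
  rw [← hg.g_lt_iff (gstar_mem ht) hz, g_gstar ht]

theorem mem_of_mem_Icc (hg : IsGeneratingFunction Γ g) {x y : Rn n} {z₁ z₂ z : ℝ}
    (h₁ : (x, y, z₁) ∈ Γ) (h₂ : (x, y, z₂) ∈ Γ) (hz₁ : z₁ ≤ z) (hz₂ : z ≤ z₂) : (x, y, z) ∈ Γ :=
  (hg.interval x y).out (x := z₁) (y := z₂) h₁ h₂ ⟨hz₁, hz₂⟩

/-- The domain of `g*`. -/
def dualDomain (Γ : Set (Rn n × Rn n × ℝ)) (g : Rn n × Rn n × ℝ → ℝ) : Set (Rn n × Rn n × ℝ) :=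
  {q | q.2.2 ∈ J Γ g q.1 q.2.1}

/-- The values of `g` at `z ± δ` lie strictly on either side of `t`, and this persists under small
changes of `(x, y, t)`. Since `J` is an interval and `g` decreases in `z`, this shows at once that
the domain of `g*` is open and that `g*` is continuous. -/
theorem eventually_dual (hg : IsGeneratingFunction Γ g) {q : Rn n × Rn n × ℝ}
    (hq : q ∈ dualDomain Γ g) {W : Set ℝ} (hW : W ∈ 𝓝 (gstar Γ g q.1 q.2.1 q.2.2)) :
    ∀ᶠ q' in 𝓝 q, q' ∈ dualDomain Γ g ∧ gstar Γ g q'.1 q'.2.1 q'.2.2 ∈ W := by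
  obtain ⟨x, y, t⟩ := q
  simp only [dualDomain, mem_ofPred_eq] at hq hW ⊢
  set z := gstar Γ g x y t with hz
  have hzI : I Γ x y ∈ 𝓝 z := (hg.isOpen_I x y).mem_nhds (gstar_mem hq)
  obtain ⟨δ, hδ, hball⟩ := Metric.nhds_basis_closedBall.mem_iff.1 (inter_mem hW hzI)
  rw [Real.closedBall_eq_Icc] at hball
  have h₁ : (x, y, z - δ) ∈ Γ := (hball ⟨le_rfl, by linarith⟩).2
  have h₂ : (x, y, z + δ) ∈ Γ := (hball ⟨by linarith, le_rfl⟩).2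
  have hc : ∀ δ', Tendsto (fun q' : Rn n × Rn n × ℝ => (q'.1, q'.2.1, z + δ')) (𝓝 (x, y, t))
      (𝓝 (x, y, z + δ')) := fun δ' =>
    (by fun_prop : Continuous fun q' : Rn n × Rn n × ℝ => (q'.1, q'.2.1, z + δ')).tendsto (x, y, t)
  have hlt₁ : t < g (x, y, z - δ) := by
    rw [← hg.lt_gstar_iff h₁ hq]
    linarith
  have hlt₂ : g (x, y, z + δ) < t := by
    rw [← not_le, ← hg.le_gstar_iff h₂ hq]
    linarith
  have ht : Tendsto (fun q' : Rn n × Rn n × ℝ => q'.2.2) (𝓝 (x, y, t)) (𝓝 t) :=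
    (by fun_prop : Continuous fun q' : Rn n × Rn n × ℝ => q'.2.2).tendsto (x, y, t)
  rw [sub_eq_add_neg] at h₁ hlt₁
  filter_upwards [(hc (-δ)).eventually (hg.isOpen.mem_nhds h₁),
    (hc δ).eventually (hg.isOpen.mem_nhds h₂),
    ht.eventually_lt ((hg.continuousAt h₁).tendsto.comp (hc (-δ))) hlt₁,
    ((hg.continuousAt h₂).tendsto.comp (hc δ)).eventually_lt ht hlt₂] with q' hm₁ hm₂ hl₁ hl₂
  have hJ : q'.2.2 ∈ J Γ g q'.1 q'.2.1 :=
    (hg.ordConnected_J _ _).out (mem_J _ _ hm₂) (mem_J _ _ hm₁) ⟨hl₂.le, hl₁.le⟩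
  refine ⟨hJ, (hball ⟨?_, ?_⟩).1⟩
  · exact (hg.le_gstar_iff hm₁ hJ).2 hl₁.le
  · exact (hg.gstar_le_iff hm₂ hJ).2 hl₂.le

theorem continuousAt_gstar (hg : IsGeneratingFunction Γ g) {q : Rn n × Rn n × ℝ}
    (hq : q ∈ dualDomain Γ g) :
    ContinuousAt (fun q : Rn n × Rn n × ℝ => gstar Γ g q.1 q.2.1 q.2.2) q :=
  fun _ hW => (hg.eventually_dual hq hW).mono fun _ h => h.2

/-- `g*` is continuous along continuous families of points of its domain. -/
theorem continuousOn_gstar_comp (hg : IsGeneratingFunction Γ g) {α : Type*} [TopologicalSpace α]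
    {s : Set α} {x y : α → Rn n} {t : α → ℝ} (hx : ContinuousOn x s) (hy : ContinuousOn y s)
    (ht : ContinuousOn t s) (h : ∀ a ∈ s, t a ∈ J Γ g (x a) (y a)) :
    ContinuousOn (fun a => gstar Γ g (x a) (y a) (t a)) s := fun a ha =>
  (hg.continuousAt_gstar (q := (x a, y a, t a)) (h a ha)).comp_continuousWithinAt
    (f := fun a => (x a, y a, t a)) ((hx a ha).prodMk ((hy a ha).prodMk (ht a ha)))

theorem continuousOn_P_comp (hg : IsGeneratingFunction Γ g) {α : Type*} [TopologicalSpace α]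
    {s : Set α} {x y : α → Rn n} {t : α → ℝ} (hx : ContinuousOn x s) (hy : ContinuousOn y s)
    (ht : ContinuousOn t s) (h : ∀ a ∈ s, t a ∈ J Γ g (x a) (y a)) :
    ContinuousOn (fun a => P Γ g (x a) (y a) (t a)) s :=
  hg.continuousOn_gx.comp (f := fun a => (x a, y a, gstar Γ g (x a) (y a) (t a)))
    (hx.prodMk (hy.prodMk (hg.continuousOn_gstar_comp hx hy ht h))) fun a ha => gstar_mem (h a ha)

end IsGeneratingFunction

theorem mem_J_of_mem_JInter {A B : Set (Rn n)} {t : ℝ} (h : t ∈ JInter Γ g A B) {x y : Rn n}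
    (hx : x ∈ A) (hy : y ∈ B) : t ∈ J Γ g x y := mem_iInter₂.1 (mem_iInter₂.1 h x hx) y hy

/-! ### The normal image stays in the closure of the target -/

/-- An integrable function that is positive almost everywhere in the open set `Ω` has a positive
integral over every subset of positive measure. -/
theorem setIntegral_pos_of_ae_pos {s : Set (Rn n)} (hsΩ : s ⊆ Ω)
    (hf : IntegrableOn f Ω) (hf_pos : ∀ᵐ x ∂(volume.restrict Ω), 0 < f x) (hs0 : volume s ≠ 0) :
    0 < ∫ x in s, f x := by
  have hpos : ∀ᵐ x ∂(volume.restrict s), 0 < f x := ae_restrict_of_ae_restrict_of_subset hsΩ hf_pos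
  rw [integral_pos_iff_support_of_nonneg_ae (hpos.mono fun x hx => hx.le) (hf.mono_set hsΩ)]
  have : (volume.restrict s) (Function.support f)ᶜ = 0 := by
    refine measure_mono_null (fun x hx => ?_) hpos
    simp only [mem_compl_iff, Function.mem_support, not_not] at hx
    simp [hx]
  rw [measure_of_measure_compl_eq_zero this, Measure.restrict_apply_univ]
  exact pos_iff_ne_zero.2 hs0

/-- The points of `Ω` at which the normal mapping meets `Ω*` are dense in `Ω`. -/
theorem IsGeneralizedSolution.exists_mem_normalMap_near
    (hu : IsGeneralizedSolution Γ g Ω Ωs f fs u) (hΩ : IsOpen Ω) (hf : IntegrableOn f Ω)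
    (hf_pos : ∀ᵐ x ∂(volume.restrict Ω), 0 < f x) {x : Rn n} (hx : x ∈ Ω) {r : ℝ} (hr : 0 < r) :
    ∃ x' ∈ Ω ∩ Metric.ball x r, (normalMap Γ g Ω u x' ∩ Ωs).Nonempty := by
  -- Otherwise a nonempty open subset of `Ω` would have image of mass zero in `Ωs`, although `f` has
  -- positive integral over it.
  by_contra! hcon
  have hopen : IsOpen (Ω ∩ Metric.ball x r) := hΩ.inter Metric.isOpen_ball
  have hempty : normalImage Γ g Ω u (Ω ∩ Metric.ball x r) ∩ Ωs = ∅ := by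
    refine eq_empty_of_forall_notMem fun y ⟨hy, hys⟩ => ?_
    obtain ⟨x', hx', hyx'⟩ := mem_iUnion₂.1 hy
    exact (hcon x' hx').subset ⟨hyx', hys⟩
  have h0 := (hu.measure_eq _ hopen.measurableSet inter_subset_left).2
  rw [hempty, setIntegral_empty] at h0
  have hpos := setIntegral_pos_of_ae_pos inter_subset_left hf hf_pos
    (hopen.measure_pos volume ⟨x, hx, Metric.mem_ball_self hr⟩).ne'
  exact hpos.ne h0

/-- At every point the graph of a generalized solution is supported from below, as far as the
supporting function is defined, by a function with parameter in the closure of `Ω*`. -/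
theorem IsGeneralizedSolution.exists_support (hg : IsGeneratingFunction Γ g)
    (hu : IsGeneralizedSolution Γ g Ω Ωs f fs u) (hΩ : IsOpen Ω) (hΩsb : Bornology.IsBounded Ωs)
    (hf : IntegrableOn f Ω) (hf_pos : ∀ᵐ x ∂(volume.restrict Ω), 0 < f x)
    (huJ : ∀ x ∈ Ω, u x ∈ JInter Γ g {x} (closure Ωs)) {x : Rn n} (hx : x ∈ Ω) :
    ∃ y ∈ closure Ωs, ∀ x' ∈ Ω, (x', y, gstar Γ g x y (u x)) ∈ Γ →
      g (x', y, gstar Γ g x y (u x)) ≤ u x' := by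
  have hnear := fun k : ℕ => hu.exists_mem_normalMap_near hΩ hf hf_pos hx
    (Nat.one_div_pos_of_nat (α := ℝ) (n := k))
  choose xk hxk yk hyk using hnear
  obtain ⟨y, hy, φ, hφ, hlim⟩ := hΩsb.isCompact_closure.tendsto_subseq
    fun k => subset_closure (hyk k).2
  have hxlim : Tendsto xk atTop (𝓝 x) := by
    rw [tendsto_iff_dist_tendsto_zero]
    exact squeeze_zero (fun _ => dist_nonneg) (fun k => (Metric.mem_ball.1 (hxk k).2).le)
      tendsto_one_div_add_atTop_nhds_zero_nat
  have hxlim' := hxlim.comp hφ.tendsto_atTop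
  have hucont : ContinuousAt u x := hu.gConvex.1.continuousAt (hΩ.mem_nhds hx)
  have hJ : u x ∈ J Γ g x y := mem_J_of_mem_JInter (huJ x hx) rfl hy
  have hz := (hg.continuousAt_gstar (q := (x, y, u x)) hJ).tendsto.comp
    (hxlim'.prodMk_nhds (hlim.prodMk_nhds (hucont.tendsto.comp hxlim')))
  refine ⟨y, hy, fun x' hx' hΓ => ?_⟩
  have hgl := (hg.continuousAt hΓ).tendsto.comp
    ((tendsto_const_nhds (x := x')).prodMk_nhds (hlim.prodMk_nhds hz))
  exact le_of_tendsto' hgl fun k => ((hyk (φ k)).1.2 x' hx').2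

/-- If `Ω*` is `g*`-convex with respect to a generalized solution, the image of its normal mapping
lies in the closure of `Ω*`. -/
theorem IsGeneralizedSolution.normalImage_subset (hg : IsGeneratingFunction Γ g) (hA1 : A1 Γ g)
    (hu : IsGeneralizedSolution Γ g Ω Ωs f fs u) (hΩ : IsOpen Ω) (hΩsb : Bornology.IsBounded Ωs)
    (hf : IntegrableOn f Ω) (hf_pos : ∀ᵐ x ∂(volume.restrict Ω), 0 < f x)
    (huJ : ∀ x ∈ Ω, u x ∈ JInter Γ g {x} (closure Ωs)) (hconv : IsGStarConvexWrt Γ g Ω Ωs u) :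
    normalImage Γ g Ω u Ω ⊆ closure Ωs := by
  intro y₁ hy₁
  obtain ⟨x₁, hx₁, hJ₁, hsup₁⟩ := mem_iUnion₂.1 hy₁
  have hcpt : IsCompact (closure Ωs) := hΩsb.isCompact_closure
  have hJ : ∀ y ∈ closure Ωs, u x₁ ∈ J Γ g x₁ y := fun y hy => mem_J_of_mem_JInter (huJ x₁ hx₁) rfl hy
  set C : Set (Rn n) := (fun y => P Γ g x₁ y (u x₁)) '' closure Ωs with hC
  have hPcont : ContinuousOn (fun y => P Γ g x₁ y (u x₁)) (closure Ωs) :=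
    hg.continuousOn_P_comp continuousOn_const continuousOn_id continuousOn_const hJ
  have hCconv : Convex ℝ C := by
    rw [hC, image_closure_of_isCompact hcpt hPcont]
    exact (hconv x₁ hx₁).2.closure
  have hCclosed : IsClosed C := (hcpt.image_of_continuousOn hPcont).isClosed
  by_cases hmem : P Γ g x₁ y₁ (u x₁) ∈ C
  · obtain ⟨y, hy, hyP⟩ := hmem
    have h : (y, gstar Γ g x₁ y (u x₁)) = (y₁, gstar Γ g x₁ y₁ (u x₁)) :=
      hA1 x₁ (IsGeneratingFunction.gstar_mem (hJ y hy)) (IsGeneratingFunction.gstar_mem hJ₁)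
        (Prod.ext_iff.2 ⟨hyP, (IsGeneratingFunction.g_gstar (hJ y hy)).trans
          (IsGeneratingFunction.g_gstar hJ₁).symm⟩)
    rwa [← (Prod.mk.inj h).1]
  exfalso
  obtain ⟨F, c, hFC, hFc⟩ := geometric_hahn_banach_closed_point hCconv hCclosed hmem
  obtain ⟨e, rfl⟩ : ∃ e, InnerProductSpace.toDual ℝ (Rn n) e = F :=
    (InnerProductSpace.toDual ℝ (Rn n)).surjective F
  simp only [InnerProductSpace.toDual_apply_apply] at hFC hFc
  have hucont : ContinuousAt u x₁ := hu.gConvex.1.continuousAt (hΩ.mem_nhds hx₁)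
  -- Compactness of `closure Ωs` makes the neighbourhood uniform in `y`. The support touches the
  -- graph over `q.1`; its gradient is evaluated at `q.2`.
  have htube : ∀ᶠ q : Rn n × Rn n in 𝓝 (x₁, x₁), ∀ y ∈ closure Ωs,
      (q.2, y, gstar Γ g q.1 y (u q.1)) ∈ Γ ∧
        inner ℝ (gx g q.2 y (gstar Γ g q.1 y (u q.1))) e < c := by
    refine hcpt.eventually_forall_of_forall_eventually fun y hy => ?_
    have hcont : ContinuousAt (fun q : (Rn n × Rn n) × Rn n =>
        (q.1.2, q.2, gstar Γ g q.1.1 q.2 (u q.1.1))) ((x₁, x₁), y) := by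
      have hu' : ContinuousAt (fun q : (Rn n × Rn n) × Rn n => u q.1.1) ((x₁, x₁), y) :=
        hucont.comp (f := fun q : (Rn n × Rn n) × Rn n => q.1.1) (by fun_prop)
      refine ContinuousAt.prodMk (by fun_prop) (ContinuousAt.prodMk (by fun_prop) ?_)
      exact (hg.continuousAt_gstar (q := (x₁, y, u x₁)) (hJ y hy)).comp
        (f := fun q : (Rn n × Rn n) × Rn n => (q.1.1, q.2, u q.1.1))
        (ContinuousAt.prodMk (by fun_prop) (ContinuousAt.prodMk (by fun_prop) hu'))
    have hΓ : (x₁, y, gstar Γ g x₁ y (u x₁)) ∈ Γ := IsGeneratingFunction.gstar_mem (hJ y hy)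
    have hgxc := hg.continuousOn_gx.continuousAt (hg.isOpen.mem_nhds hΓ)
    have hin : ∀ᶠ p : Rn n × Rn n × ℝ in 𝓝 (x₁, y, gstar Γ g x₁ y (u x₁)),
        inner ℝ (gx g p.1 p.2.1 p.2.2) e < c := by
      refine (ContinuousAt.inner (𝕜 := ℝ) hgxc continuousAt_const).eventually_lt
        continuousAt_const ?_
      rw [real_inner_comm]
      exact hFC _ ⟨y, hy, rfl⟩
    exact hcont.eventually ((hg.isOpen.eventually_mem hΓ).and hin)
  have hΓ₁ : (x₁, y₁, gstar Γ g x₁ y₁ (u x₁)) ∈ Γ := IsGeneratingFunction.gstar_mem hJ₁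
  rw [nhds_prod_eq] at htube
  obtain ⟨W, hW, hWsub⟩ := Filter.mem_prod_same_iff.1 htube
  obtain ⟨ρ, hρ, hρball⟩ := Metric.mem_nhds_iff.1 hW
  have htube' : ∀ x ∈ Metric.ball x₁ ρ, ∀ x' ∈ Metric.ball x₁ ρ, ∀ y ∈ closure Ωs,
      (x', y, gstar Γ g x y (u x)) ∈ Γ ∧ inner ℝ (gx g x' y (gstar Γ g x y (u x))) e < c :=
    fun x hx x' hx' => @hWsub (x, x') ⟨hρball hx, hρball hx'⟩
  have hline : Tendsto (fun s : ℝ => x₁ + s • e) (𝓝[>] 0) (𝓝 x₁) := by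
    have : ContinuousAt (fun s : ℝ => x₁ + s • e) 0 := by fun_prop
    have h := this.tendsto.mono_left (nhdsWithin_le_nhds (s := Ioi 0))
    simpa using h
  have hderiv : HasDerivAt (fun s : ℝ => g (x₁ + s • e, y₁, gstar Γ g x₁ y₁ (u x₁)))
      (inner ℝ (P Γ g x₁ y₁ (u x₁)) e) 0 := by
    simpa [P] using hg.hasDerivAt_line (x := x₁) (e := e) (s := 0) (by simpa using hΓ₁)
  rw [real_inner_comm] at hFc
  have hslope := ((hasDerivAt_iff_tendsto_slope.1 hderiv).mono_left
    (nhdsWithin_mono _ fun s (hs : 0 < s) => hs.ne')).eventually_const_lt hFc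
  -- The support with parameter `y₁` gives `u (x₁ + s • e) > u x₁ + c * s`.
  obtain ⟨s, ⟨hs0, hball, hsΩ⟩, hs⟩ := ((eventually_mem_nhdsWithin.and
    ((hline.eventually (Metric.ball_mem_nhds x₁ hρ)).and
      (hline.eventually (hΩ.mem_nhds hx₁)))).and hslope).exists
  have hs0 : 0 < s := hs0
  have hball : x₁ + s • e ∈ Metric.ball x₁ ρ := hball
  have hsΩ : x₁ + s • e ∈ Ω := hsΩ
  rw [slope_def_field, sub_zero, lt_div_iff₀ hs0] at hs
  simp only [zero_smul, add_zero] at hs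
  rw [IsGeneratingFunction.g_gstar hJ₁] at hs
  have hsup := (hsup₁ _ hsΩ).2
  obtain ⟨y, hy, hsupy⟩ := hu.exists_support hg hΩ hΩsb hf hf_pos huJ hsΩ
  set x := x₁ + s • e with hxdef
  have hseg : ∀ s' ∈ Icc 0 s, x₁ + s' • e ∈ Metric.ball x₁ ρ := by
    intro s' hs'
    rw [hxdef, Metric.mem_ball, dist_self_add_left, norm_smul] at hball
    rw [Metric.mem_ball, dist_self_add_left, norm_smul]
    refine lt_of_le_of_lt ?_ hball
    gcongr
    rw [Real.norm_of_nonneg hs'.1, Real.norm_of_nonneg hs0.le]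
    exact hs'.2
  have hd : ∀ s' ∈ Icc 0 s, HasDerivAt (fun s' : ℝ => g (x₁ + s' • e, y, gstar Γ g x y (u x)))
      (inner ℝ (gx g (x₁ + s' • e) y (gstar Γ g x y (u x))) e) s' := fun s' hs' =>
    hg.hasDerivAt_line (htube' x hball _ (hseg s' hs') y hy).1
  -- By the mean value theorem the support at `x` gains less than `c * s` between `x₁` and `x`. As
  -- it lies below `u` at `x₁`, this gives `u x < u x₁ + c * s`.
  obtain ⟨s', hs', heq⟩ := exists_hasDerivAt_eq_slope _ _ hs0
    (fun s' hs' => (hd s' hs').continuousAt.continuousWithinAt)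
    fun s' hs' => hd s' (Ioo_subset_Icc_self hs')
  have hlt := (htube' x hball _ (hseg s' (Ioo_subset_Icc_self hs')) y hy).2
  rw [heq, sub_zero, div_lt_iff₀ hs0, zero_smul, add_zero, ← hxdef,
    IsGeneratingFunction.g_gstar (mem_J_of_mem_JInter (huJ x hsΩ) rfl hy)] at hlt
  have h1 := hsupy x₁ hx₁ (htube' x hball x₁ (Metric.mem_ball_self hρ) y hy).1
  linarith

/-! ### Lower bounds along curves and the use of A5 -/

/-- A function that is locally `K`-Lipschitz in `Ω` is `K`-Lipschitz for the distance along curves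
in `Ω`. -/
theorem edist_le_of_pathDist_lt {H : Rn n → ℝ} {K : NNReal}
    (hH : ∀ x ∈ Ω, ∃ W ∈ 𝓝 x, LipschitzOnWith K H W) {x x' : Rn n} {L : ℝ≥0∞}
    (hL : pathDist Ω x x' < L) : edist (H x) (H x') ≤ K * L := by
  obtain ⟨γ, hγ⟩ := iInf_lt_iff.1 hL
  obtain ⟨⟨hγc, hγΩ, rfl, rfl⟩, hγL⟩ := iInf_lt_iff.1 hγ
  have hW : ∀ r : Icc (0 : ℝ) 1, ∃ W : Set (Rn n), IsOpen W ∧ γ r ∈ W ∧ LipschitzOnWith K H W := by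
    intro r
    obtain ⟨W, hW, hlip⟩ := hH (γ r) (hγΩ r.2)
    obtain ⟨W', hW', hW'o, hr⟩ := mem_nhds_iff.1 hW
    exact ⟨W', hW'o, hr, hlip.mono hW'⟩
  choose W hWo hmem hlip using hW
  have hγ' : Continuous fun r : Icc (0 : ℝ) 1 => γ r := continuousOn_iff_continuous_domRestrict.1 hγc
  -- A partition so fine that each piece of the curve stays in one of the sets `W r`; the variations
  -- of the pieces add up.
  obtain ⟨t, ht0, htm, ⟨m, hm⟩, hsub⟩ := exists_monotone_Icc_subset_open_cover_unitInterval
    (c := fun r => (fun s : Icc (0 : ℝ) 1 => γ s) ⁻¹' W r) (fun r => (hWo r).preimage hγ')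
    (fun r _ => mem_iUnion.2 ⟨r, hmem r⟩)
  have hind : ∀ k, edist (H (γ 0)) (H (γ (t k))) ≤
      K * eVariationOn γ (Icc 0 1 ∩ Icc 0 (t k : ℝ)) := by
    intro k
    induction k with
    | zero => simp [ht0]
    | succ k ih =>
      have hle : (t k : ℝ) ≤ t (k + 1) := htm (Nat.le_succ k)
      rw [← eVariationOn.Icc_add_Icc γ (t k).2.1 hle (t k).2, mul_add]
      refine (edist_triangle _ (H (γ (t k))) _).trans (add_le_add ih ?_)
      obtain ⟨r, hr⟩ := hsub k
      refine (hlip r (hr ⟨le_rfl, hle⟩) (hr ⟨hle, le_rfl⟩)).trans ?_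
      gcongr
      exact eVariationOn.edist_le γ ⟨(t k).2, le_rfl, hle⟩ ⟨(t (k + 1)).2, hle, le_rfl⟩
  have h1 := hind m
  rw [hm m le_rfl] at h1
  refine h1.trans ?_
  gcongr
  refine le_trans (eVariationOn.mono γ inter_subset_left) hγL.le

/-- A function whose gradient is bounded by `K₀` where its values lie between `α` and `β` does not
fall below `α` within distance `d` along curves of a point at which its value is larger than
`α + K₀ d`. -/
theorem lt_of_norm_gradient_le {h : Rn n → ℝ} {α β K₀ d : ℝ} (hh : ∀ x ∈ Ω, ContDiffAt ℝ 2 h x)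
    (hK₀ : 0 ≤ K₀) (hd : 0 ≤ d)
    (hgrad : ∀ x ∈ Ω, h x ∈ Icc α β → ‖gradient h x‖ ≤ K₀) {x₀ x : Rn n}
    (hdist : pathDist Ω x₀ x ≤ ENNReal.ofReal d)
    (hα : α + K₀ * d < h x₀) (hβ : α + K₀ * d < β) : α < h x := by
  -- The slack `δ` pays twice: for curves whose length only approaches the distance, and for a local
  -- Lipschitz constant that must exceed the norm of the derivative.
  obtain ⟨δ, hδ, hδlt⟩ : ∃ δ > 0, (K₀ + δ) * (d + δ) < min (h x₀) β - α := by
    have hlim : Tendsto (fun δ : ℝ => (K₀ + δ) * (d + δ)) (𝓝[>] 0) (𝓝 ((K₀ + 0) * (d + 0))) :=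
      ((by fun_prop : Continuous fun δ : ℝ => (K₀ + δ) * (d + δ)).tendsto 0).mono_left
        nhdsWithin_le_nhds
    have hlt : (K₀ + 0) * (d + 0) < min (h x₀) β - α := by
      rw [lt_sub_iff_add_lt, lt_min_iff]
      constructor <;> linarith
    obtain ⟨δ, h1, h2⟩ := ((hlim.eventually_lt_const hlt).and self_mem_nhdsWithin).exists
    exact ⟨δ, h2, h1⟩
  -- Clamping the values to `[α, β]` makes `h` locally constant where the gradient bound is not
  -- available.
  have hclamp : LipschitzWith 1 fun r : ℝ => max α (min β r) :=
    (LipschitzWith.id.const_min β).const_max α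
  have hlip : ∀ y ∈ Ω, ∃ W ∈ 𝓝 y,
      LipschitzOnWith (Real.toNNReal (K₀ + δ)) (fun y => max α (min β (h y))) W := by
    intro y hy
    have hc := (hh y hy).continuousAt
    have hconst : ∀ c : ℝ, (∀ᶠ y' in 𝓝 y, max α (min β (h y')) = c) → ∃ W ∈ 𝓝 y,
        LipschitzOnWith (Real.toNNReal (K₀ + δ)) (fun y => max α (min β (h y))) W := by
      intro c hW
      refine ⟨_, hW, fun a ha b hb => ?_⟩
      have ha : max α (min β (h a)) = c := ha
      have hb : max α (min β (h b)) = c := hb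
      simp [ha, hb]
    have hαβ : α ≤ β := by nlinarith [mul_nonneg hK₀ hd]
    rcases lt_or_ge (h y) α with h1 | h1
    · refine hconst α ((hc.eventually_lt_const h1).mono fun y' hy' => ?_)
      exact max_eq_left ((min_le_right _ _).trans hy'.le)
    rcases lt_or_ge β (h y) with h2 | h2
    · refine hconst β ((hc.eventually_const_lt h2).mono fun y' hy' => ?_)
      rw [min_eq_left hy'.le, max_eq_right hαβ]
    have hn : ‖fderiv ℝ h y‖ ≤ K₀ := by
      have := hgrad y hy ⟨h1, h2⟩
      rwa [gradient, LinearIsometryEquiv.norm_map] at this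
    obtain ⟨W, hW, hl⟩ := ((hh y hy).hasStrictFDerivAt two_ne_zero).exists_lipschitzOnWith_of_nnnorm_lt
      (Real.toNNReal (K₀ + δ)) (by
        rw [← NNReal.coe_lt_coe, coe_nnnorm, Real.coe_toNNReal _ (by positivity)]
        linarith)
    refine ⟨W, hW, ?_⟩
    have := hclamp.comp_lipschitzOnWith hl
    rwa [one_mul] at this
  have hed := edist_le_of_pathDist_lt hlip (x := x₀) (x' := x) (L := ENNReal.ofReal (d + δ))
    (hdist.trans_lt ((ENNReal.ofReal_lt_ofReal_iff (by positivity)).2 (by linarith)))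
  have hKe : ((Real.toNNReal (K₀ + δ) : NNReal) : ℝ≥0∞) = ENNReal.ofReal (K₀ + δ) := rfl
  rw [hKe, ← ENNReal.ofReal_mul (by positivity), edist_dist,
    ENNReal.ofReal_le_ofReal_iff (by positivity), Real.dist_eq] at hed
  have h3 := (abs_le.1 hed).2
  have h4 : min (h x₀) β ≤ max α (min β (h x₀)) := by
    rw [min_comm]
    exact le_max_right _ _
  have h5 : α < max α (min β (h x)) := by linarith
  rcases lt_max_iff.1 h5 with h6 | h6
  · exact absurd h6 (lt_irrefl _)
  · exact (lt_min_iff.1 h6).2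

/-- A level `t` in `J₀` below all functions `g(·, y, z)`, `y ∈ Ω*`, with the value `u₀` at `x₀`. -/
theorem A5.exists_level {U V : Set (Rn n)} (hg : IsGeneratingFunction Γ g)
    (hUV : IsAdmissiblePair Γ g U V) (hΩb : Bornology.IsBounded Ω) (hΩU : closure Ω ⊆ U)
    (hΩsb : Bornology.IsBounded Ωs) (hΩsV : closure Ωs ⊆ V) {m₀ M₀ : EReal} {K₀ : ℝ}
    (hA5 : A5 Γ g U V Ω Ωs m₀ M₀ K₀) {x₀ : Rn n} (hx₀ : x₀ ∈ Ω) {u₀ : ℝ}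
    (hu₀ : u₀ ∈ JInter Γ g U V) (hlt : m₀ + K1 K₀ Ω < (u₀ : EReal)) :
    ∃ t ∈ J0 m₀ M₀, ∀ x ∈ closure Ω, ∀ y ∈ closure Ωs, t < g (x, y, gstar Γ g x₀ y u₀) := by
  have hx₀U : x₀ ∈ U := hΩU (subset_closure hx₀)
  have hΓ : ∀ x ∈ closure Ω, ∀ y ∈ closure Ωs, (x, y, gstar Γ g x₀ y u₀) ∈ Γ := fun x hx y hy =>
    hUV.2.2 x (hΩU hx) y (hΩsV hy) x₀ hx₀U y (hΩsV hy) u₀ hu₀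
  rcases eq_or_ne m₀ ⊥ with rfl | hm₀
  · have hcont : ContinuousOn (fun q : Rn n × Rn n => g (q.1, q.2, gstar Γ g x₀ q.2 u₀))
        (closure Ω ×ˢ closure Ωs) := by
      refine hg.continuousOn.comp (f := fun q : Rn n × Rn n => (q.1, q.2, gstar Γ g x₀ q.2 u₀))
        (continuousOn_fst.prodMk (continuousOn_snd.prodMk
          (hg.continuousOn_gstar_comp continuousOn_const continuousOn_snd continuousOn_const
            fun q hq => ?_))) fun q hq => hΓ _ hq.1 _ hq.2
      exact mem_J_of_mem_JInter hu₀ hx₀U (hΩsV hq.2)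
    obtain ⟨b, hb⟩ := ((hΩb.isCompact_closure.prod hΩsb.isCompact_closure).image_of_continuousOn
      hcont).bddBelow
    obtain ⟨t, ht, htlt⟩ := EReal.lt_iff_exists_real_btwn.1
      (lt_min (EReal.bot_lt_coe b) hA5.lt)
    rw [lt_min_iff] at htlt
    refine ⟨t, ⟨ht, htlt.2⟩, fun x hx y hy => ?_⟩
    have h1 : t < b := by exact_mod_cast htlt.1
    exact h1.trans_le (hb ⟨(x, y), ⟨hx, hy⟩, rfl⟩)
  · have hd : diamIn Ω ≠ ⊤ := by
      intro hd
      rw [K1, hd, EReal.coe_ennreal_top, EReal.coe_mul_top_of_pos hA5.pos,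
        EReal.add_top_of_ne_bot hm₀] at hlt
      exact absurd hlt (not_lt.2 le_top)
    lift m₀ to ℝ using ⟨hA5.lt.ne_top, hm₀⟩
    obtain ⟨d, hd0, hdd⟩ : ∃ d : ℝ, 0 ≤ d ∧ diamIn Ω = ENNReal.ofReal d :=
      ⟨(diamIn Ω).toReal, ENNReal.toReal_nonneg, (ENNReal.ofReal_toReal hd).symm⟩
    have hK1 : K1 K₀ Ω = ((K₀ * d : ℝ) : EReal) := by
      rw [K1, hdd, EReal.coe_ennreal_ofReal, max_eq_left hd0, EReal.coe_mul]
    rw [hK1, ← EReal.coe_add, EReal.coe_lt_coe_iff] at hlt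
    have hKd : 0 ≤ K₀ * d := mul_nonneg hA5.pos.le hd0
    have hltM : ((m₀ + K₀ * d : ℝ) : EReal) < M₀ := by
      have hsmall := hA5.small
      rw [hK1] at hsmall
      have hne : M₀ ≠ ⊥ := (bot_le.trans_lt hA5.lt).ne'
      induction M₀ with
      | bot => exact absurd rfl hne
      | top => exact EReal.coe_lt_top _
      | coe M =>
        rw [← EReal.coe_sub] at hsmall
        have h2 := hsmall (EReal.coe_ne_top _)
        have h3 : (2 : EReal) * ((K₀ * d : ℝ) : EReal) = ((2 * (K₀ * d) : ℝ) : EReal) := by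
          rw [EReal.coe_mul 2]
          rfl
        rw [h3, EReal.coe_lt_coe_iff] at h2
        rw [EReal.coe_lt_coe_iff]
        linarith
    obtain ⟨β, hβ, hβM⟩ := EReal.lt_iff_exists_real_btwn.1 hltM
    rw [EReal.coe_lt_coe_iff] at hβ
    -- Both `u₀` and `β` exceed `α + K₀ * d`. The level `t` is taken strictly below `α`, because
    -- only `α ≤ g` survives the passage to the closure of `Ω`.
    obtain ⟨α, hα, hαlt⟩ := exists_between
      (show m₀ < min u₀ β - K₀ * d by rw [lt_sub_iff_add_lt, lt_min_iff]; exact ⟨hlt, hβ⟩)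
    rw [lt_sub_iff_add_lt, lt_min_iff] at hαlt
    obtain ⟨t, ht, htα⟩ := exists_between hα
    have hαβ : α < β := by linarith
    have hJ0 : ∀ r ∈ Icc α β, r ∈ J0 (m₀ : EReal) M₀ := fun r hr =>
      ⟨EReal.coe_lt_coe_iff.2 (hα.trans_le hr.1), (EReal.coe_le_coe_iff.2 hr.2).trans_lt hβM⟩
    have htM : (t : EReal) < M₀ := (EReal.coe_lt_coe_iff.2 (htα.trans hαβ)).trans hβM
    refine ⟨t, ⟨EReal.coe_lt_coe_iff.2 ht, htM⟩, fun x hx y hy => htα.trans_le ?_⟩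
    have hin : ∀ x ∈ Ω, α < g (x, y, gstar Γ g x₀ y u₀) := by
      intro x hx
      refine lt_of_norm_gradient_le (h := fun x => g (x, y, gstar Γ g x₀ y u₀)) (Ω := Ω) (x₀ := x₀)
        (x := x) (K₀ := K₀) (d := d)
        (β := β) (fun x hx => ?_) hA5.pos.le hd0 (fun x hx hxI => ?_) ?_ ?_ hαlt.2
      · exact (hg.contDiffAt (hΓ x (subset_closure hx) y hy)).comp (f := fun x' : Rn n =>
          (x', y, gstar Γ g x₀ y u₀)) x (by fun_prop)
      · exact hA5.bound x (subset_closure hx) y hy _ (hΓ x (subset_closure hx) y hy) (hJ0 _ hxI)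
      · rw [← hdd]
        exact le_iSup₂_of_le x₀ hx₀ (le_iSup₂_of_le x hx le_rfl)
      · rw [IsGeneratingFunction.g_gstar (mem_J_of_mem_JInter hu₀ hx₀U (hΩsV hy))]
        exact hαlt.1
    have hne := mem_closure_iff_nhdsWithin_neBot.1 hx
    have hc : ContinuousAt (fun x => g (x, y, gstar Γ g x₀ y u₀)) x :=
      (hg.continuousAt (hΓ x hx y hy)).comp (f := fun x' : Rn n => (x', y, gstar Γ g x₀ y u₀))
        (by fun_prop)
    exact ge_of_tendsto (hc.tendsto.mono_left nhdsWithin_le_nhds)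
      (eventually_mem_nhdsWithin.mono fun x' hx' => (hin x' hx').le)

/-! ### Support sets and their potentials -/

/-- A compact set `S` of triples `(x, y, z)` such that the functions `g(·, y, z)` are defined in the
closure of `Ω` and, at `x`, `g(·, y, z)` is the largest of them. -/
structure IsSupportSet (Γ : Set (Rn n × Rn n × ℝ)) (g : Rn n × Rn n × ℝ → ℝ) (Ω Ωs : Set (Rn n))
    (S : Set (Rn n × Rn n × ℝ)) : Prop where
  isCompact : IsCompact S
  nonempty : S.Nonempty
  fst_mem : ∀ p ∈ S, p.1 ∈ closure Ω
  snd_mem : ∀ p ∈ S, p.2.1 ∈ closure Ωs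
  mem : ∀ p ∈ S, ∀ x ∈ closure Ω, (x, p.2) ∈ Γ
  le : ∀ p ∈ S, ∀ q ∈ S, g (p.1, q.2) ≤ g p

/-- The upper envelope of the functions `g(·, y, z)`, `(x, y, z) ∈ S`. -/
noncomputable def potential (g : Rn n × Rn n × ℝ → ℝ) (S : Set (Rn n × Rn n × ℝ)) (x : Rn n) : ℝ :=
  sSup ((fun p => g (x, p.2)) '' S)

namespace IsSupportSet

variable {S : Set (Rn n × Rn n × ℝ)}

theorem continuousOn_slice (hg : IsGeneratingFunction Γ g) (hS : IsSupportSet Γ g Ω Ωs S) {x : Rn n}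
    (hx : x ∈ closure Ω) : ContinuousOn (fun p : Rn n × Rn n × ℝ => g (x, p.2)) S :=
  hg.continuousOn.comp (by fun_prop) fun p hp => hS.mem p hp x hx

theorem le_potential (hg : IsGeneratingFunction Γ g) (hS : IsSupportSet Γ g Ω Ωs S) {x : Rn n}
    (hx : x ∈ closure Ω) {p : Rn n × Rn n × ℝ} (hp : p ∈ S) : g (x, p.2) ≤ potential g S x :=
  le_csSup (hS.isCompact.image_of_continuousOn (hS.continuousOn_slice hg hx)).bddAbove ⟨p, hp, rfl⟩

theorem exists_eq_potential (hg : IsGeneratingFunction Γ g) (hS : IsSupportSet Γ g Ω Ωs S) {x : Rn n}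
    (hx : x ∈ closure Ω) : ∃ p ∈ S, potential g S x = g (x, p.2) := by
  obtain ⟨p, hp, h⟩ := (hS.isCompact.image_of_continuousOn (hS.continuousOn_slice hg hx)).sSup_mem
    (hS.nonempty.image _)
  exact ⟨p, hp, h.symm⟩

theorem potential_eq (hg : IsGeneratingFunction Γ g) (hS : IsSupportSet Γ g Ω Ωs S)
    {p : Rn n × Rn n × ℝ} (hp : p ∈ S) : potential g S p.1 = g p := by
  refine le_antisymm ?_ (hS.le_potential hg (hS.fst_mem p hp) hp)
  obtain ⟨q, hq, h⟩ := hS.exists_eq_potential hg (hS.fst_mem p hp)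
  exact h.trans_le (hS.le p hp q hq)

theorem continuousOn_potential (hg : IsGeneratingFunction Γ g) (hS : IsSupportSet Γ g Ω Ωs S) :
    ContinuousOn (potential g S) (closure Ω) := by
  rw [continuousOn_iff_continuous_domRestrict]
  have : CompactSpace S := isCompact_iff_compactSpace.1 hS.isCompact
  have hc : Continuous fun q : closure Ω × S => g (q.1, (q.2 : Rn n × Rn n × ℝ).2) := by
    have h := hg.continuousOn.comp_continuous
      (f := fun q : closure Ω × S => ((q.1 : Rn n), (q.2 : Rn n × Rn n × ℝ).2)) (by fun_prop)
      fun q => hS.mem q.2 q.2.2 q.1 q.1.2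
    exact h
  refine (isCompact_univ.continuous_sSup (f := fun (x : closure Ω) (p : S) =>
    g (x, (p : Rn n × Rn n × ℝ).2)) hc).congr fun x => ?_
  change _ = sSup _
  congr 1
  ext r
  simp

theorem isGConvex_potential (hg : IsGeneratingFunction Γ g) (hS : IsSupportSet Γ g Ω Ωs S) :
    IsGConvex Γ g Ω (potential g S) := by
  refine ⟨(hS.continuousOn_potential hg).mono subset_closure, fun x hx => ?_⟩
  obtain ⟨p, hp, h⟩ := hS.exists_eq_potential hg (subset_closure hx)
  exact ⟨p.2.1, p.2.2, mem_iInter₂.2 fun x' hx' => hS.mem p hp x' (subset_closure hx'), h,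
    fun x' hx' => hS.le_potential hg (subset_closure hx') hp⟩

/-- The link between couplings and the normal mapping: a measure carried by `S` is carried by pairs
`(x, y)` with `y ∈ Tu(x)`. -/
theorem mem_normalMap (hg : IsGeneratingFunction Γ g) (hS : IsSupportSet Γ g Ω Ωs S)
    {p : Rn n × Rn n × ℝ} (hp : p ∈ S) : p.2.1 ∈ normalMap Γ g Ω (potential g S) p.1 := by
  have hΓ := hS.mem p hp p.1 (hS.fst_mem p hp)
  have hz : gstar Γ g p.1 p.2.1 (potential g S p.1) = p.2.2 := by
    rw [hS.potential_eq hg hp]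
    exact hg.gstar_g hΓ
  refine ⟨by rw [hS.potential_eq hg hp]; exact IsGeneratingFunction.mem_J _ _ hΓ, fun x hx => ?_⟩
  rw [hz]
  exact ⟨hS.mem p hp x (subset_closure hx), hS.le_potential hg (subset_closure hx) hp⟩

/-- Of two prices for the same good, neither can be the lower one, since the buyer paying the higher
price would prefer it. -/
theorem snd_unique (hg : IsGeneratingFunction Γ g) (hS : IsSupportSet Γ g Ω Ωs S)
    {p q : Rn n × Rn n × ℝ} (hp : p ∈ S) (hq : q ∈ S) (h : p.2.1 = q.2.1) : p.2.2 = q.2.2 := by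
  have key : ∀ {p q : Rn n × Rn n × ℝ}, p ∈ S → q ∈ S → p.2.1 = q.2.1 → p.2.2 ≤ q.2.2 := by
    rintro ⟨x, y, z⟩ ⟨x', y', z'⟩ hp hq h
    obtain rfl : y = y' := h
    exact (hg.g_le_iff (hS.mem _ hq x (hS.fst_mem _ hp)) (hS.mem _ hp x (hS.fst_mem _ hp))).1
      (hS.le _ hp _ hq)
  exact le_antisymm (key hp hq h) (key hq hp h.symm)

end IsSupportSet

/-! ### Construction of the support set -/

/-- Existence of a support set for the potential with the value `u₀` at `x₀`, together with a
coupling of two given measures which it carries. -/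
theorem exists_isSupportSet {U V : Set (Rn n)} (hg : IsGeneratingFunction Γ g)
    (hUV : IsAdmissiblePair Γ g U V) (hΩb : Bornology.IsBounded Ω) (hΩU : closure Ω ⊆ U)
    (hΩsb : Bornology.IsBounded Ωs) (hΩsV : closure Ωs ⊆ V) {x₀ : Rn n} (hx₀ : x₀ ∈ Ω) {u₀ t : ℝ}
    (hu₀ : u₀ ∈ JInter Γ g U V) (ht : t ∈ JInter Γ g U V)
    (hlevel : ∀ x ∈ closure Ω, ∀ y ∈ closure Ωs, t < g (x, y, gstar Γ g x₀ y u₀))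
    (μ ν : Measure (Rn n)) [IsProbabilityMeasure μ] [IsProbabilityMeasure ν]
    (hμ : μ (closure Ω)ᶜ = 0) (hν : ν (closure Ωs)ᶜ = 0) :
    ∃ (S : Set (Rn n × Rn n × ℝ)) (π : Measure (Rn n × Rn n × ℝ)), IsSupportSet Γ g Ω Ωs S ∧
      π Sᶜ = 0 ∧ π.map (fun p => p.1) = μ ∧ π.map (fun p => p.2.1) = ν ∧
      potential g S x₀ = u₀ ∧ ∀ p ∈ S, gstar Γ g x₀ p.2.1 u₀ ≤ p.2.2 := by
  have hx₀U : x₀ ∈ U := hΩU (subset_closure hx₀)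
  have hΓ : ∀ {s : ℝ}, s ∈ JInter Γ g U V → ∀ x ∈ closure Ω, ∀ x' ∈ closure Ω, ∀ y ∈ closure Ωs,
      (x, y, gstar Γ g x' y s) ∈ Γ := fun hs x hx x' hx' y hy =>
    hUV.2.2 x (hΩU hx) y (hΩsV hy) x' (hΩU hx') y (hΩsV hy) _ hs
  have hJ : ∀ {s : ℝ}, s ∈ JInter Γ g U V → ∀ x ∈ closure Ω, ∀ y ∈ closure Ωs, s ∈ J Γ g x y :=
    fun hs x hx y hy => mem_J_of_mem_JInter hs (hΩU hx) (hΩsV hy)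
  have hx₀c : x₀ ∈ closure Ω := subset_closure hx₀
  have : CompactSpace (closure Ω) := isCompact_iff_compactSpace.1 hΩb.isCompact_closure
  have : CompactSpace (closure Ωs) := isCompact_iff_compactSpace.1 hΩsb.isCompact_closure
  -- At the reserve price `a y` the good `y` is worth `u₀` to `x₀`; at the price `b (x, y)` it is
  -- worth `t` to `x`.
  let a : closure Ωs → ℝ := fun y => gstar Γ g x₀ y u₀
  let b : closure Ω × closure Ωs → ℝ := fun q => gstar Γ g q.1 q.2 t
  have ha : Continuous a := by
    rw [← continuousOn_univ]
    exact hg.continuousOn_gstar_comp continuousOn_const continuous_subtype_val.continuousOn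
      continuousOn_const fun y _ => hJ hu₀ _ hx₀c _ y.2
  have hb : Continuous b := by
    rw [← continuousOn_univ]
    exact hg.continuousOn_gstar_comp (continuous_subtype_val.comp continuous_fst).continuousOn
      (continuous_subtype_val.comp continuous_snd).continuousOn
      continuousOn_const fun q _ => hJ ht _ q.1.2 _ q.2.2
  have hΓa : ∀ (x : closure Ω) (y : closure Ωs), ((x : Rn n), (y : Rn n), a y) ∈ Γ := fun x y =>
    hΓ hu₀ x x.2 x₀ hx₀c y y.2
  have hΓb : ∀ (x x' : closure Ω) (y : closure Ωs), ((x : Rn n), (y : Rn n), b (x', y)) ∈ Γ :=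
    fun x x' y => hΓ ht x x.2 x' x'.2 y y.2
  have hgb : ∀ (x : closure Ω) (y : closure Ωs), g (x, y, b (x, y)) = t := fun x y =>
    IsGeneratingFunction.g_gstar (hJ ht x x.2 y y.2)
  have hab : ∀ x y, a y < b (x, y) := fun x y =>
    (hg.lt_gstar_iff (hΓa x y) (hJ ht x x.2 y y.2)).2 (hlevel x x.2 y y.2)
  -- The price clamped to `[a, b]`: it keeps the argument of `g` in `Γ` and makes the utility equal
  -- to `t` from `b` on.
  let c : closure Ω × closure Ωs × ℝ → ℝ := fun r => max (a r.2.1) (min r.2.2 (b (r.1, r.2.1)))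
  have hac : ∀ r, a r.2.1 ≤ c r := fun r => le_max_left _ _
  have hcb : ∀ r, c r ≤ b (r.1, r.2.1) := fun r => max_le (hab _ _).le (min_le_right _ _)
  have hΓc : ∀ r : closure Ω × closure Ωs × ℝ, ((r.1 : Rn n), (r.2.1 : Rn n), c r) ∈ Γ := fun r =>
    hg.mem_of_mem_Icc (hΓa r.1 r.2.1) (hΓb r.1 r.1 r.2.1) (hac r) (hcb r)
  have hc : Continuous c := by fun_prop
  let G : closure Ω × closure Ωs × ℝ → ℝ := fun r => g (r.1, r.2.1, c r)
  have hG : Continuous G := hg.continuousOn.comp_continuous (by fun_prop) hΓc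
  have hanti : ∀ x y, Antitone fun z => G (x, y, z) := fun x y z z' hzz' =>
    (hg.g_le_iff (hΓc (x, y, z')) (hΓc (x, y, z))).2
      (max_le_max le_rfl (min_le_min hzz' le_rfl))
  have hGb : ∀ x y z, b (x, y) ≤ z → G (x, y, z) = t := fun x y z hz => by
    have : c (x, y, z) = b (x, y) := by
      simp only [c]
      rw [min_eq_right hz, max_eq_right (hab x y).le]
    simp only [G, this]
    exact hgb x y
  have hGmid : ∀ x y z, a y ≤ z → z ≤ b (x, y) → G (x, y, z) = g (x, y, z) := fun x y z h₁ h₂ => by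
    have : c (x, y, z) = z := by
      simp only [c]
      rw [min_eq_left h₂, max_eq_right h₁]
    simp only [G, this]
  have hGa : ∀ x y, t < G (x, y, a y) := fun x y => by
    rw [hGmid x y _ le_rfl (hab x y).le]
    exact hlevel x x.2 y y.2
  obtain ⟨B, hB⟩ := (isCompact_range hb).bddAbove
  have hprob : ∀ (A : Set (Rn n)) (ρ : Measure (Rn n)) [IsProbabilityMeasure ρ],
      ρ (closure A)ᶜ = 0 → IsProbabilityMeasure (ρ.comap ((↑) : closure A → Rn n)) ∧
      (ρ.comap ((↑) : closure A → Rn n)).map (↑) = ρ := by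
    intro A ρ _ h0
    have hemb : MeasurableEmbedding ((↑) : closure A → Rn n) :=
      MeasurableEmbedding.subtype_coe isClosed_closure.measurableSet
    constructor
    · constructor
      rw [hemb.comap_apply, image_univ, Subtype.range_coe]
      rw [prob_compl_eq_zero_iff isClosed_closure.measurableSet] at h0
      exact h0
    · rw [hemb.map_comap, Subtype.range_coe]
      exact Measure.restrict_eq_self_of_ae_mem h0
  obtain ⟨_, hμmap⟩ := hprob Ω μ hμ
  obtain ⟨_, hνmap⟩ := hprob Ωs ν hν
  obtain ⟨S, π, hScomp, hπ, hπ₁, hπ₂, hSa, ⟨p₀, hp₀, hp₀a⟩, hSle⟩ := exists_stable_plan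
    (μ.comap ((↑) : closure Ω → Rn n)) (ν.comap ((↑) : closure Ωs → Rn n)) hG hanti ha (B := B)
    fun x y y' z hz => by
      rw [hGb x y' z ((hB ⟨(x, y'), rfl⟩).trans hz)]
      exact hGa x y
  -- Every buyer could have the good of `p₀` at its reserve price, which is worth more than `t`.
  -- Hence the truncation is inactive at the triples of `S`.
  have htG : ∀ p ∈ S, t < G p := fun p hp => by
    refine (hGa p.1 p₀.2.1).trans_le ?_
    rw [← hp₀a]
    exact hSle p hp p₀ hp₀
  have hSb : ∀ p ∈ S, p.2.2 < b (p.1, p.2.1) := fun p hp => by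
    by_contra! hcon
    exact (htG p hp).ne' (hGb p.1 p.2.1 p.2.2 hcon)
  have hSΓ : ∀ p ∈ S, ∀ x : closure Ω, ((x : Rn n), (p.2.1 : Rn n), p.2.2) ∈ Γ := fun p hp x =>
    hg.mem_of_mem_Icc (hΓa x p.2.1) (hΓb x p.1 p.2.1) (hSa p hp) (hSb p hp).le
  -- At other points `x` the truncation can only raise the utility, so stability for `G` implies
  -- stability for `g`.
  have hgG : ∀ p ∈ S, ∀ x : closure Ω, g (x, p.2.1, p.2.2) ≤ G (x, p.2) := fun p hp x => by
    rcases le_total p.2.2 (b (x, p.2.1)) with h | h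
    · exact (hGmid x p.2.1 p.2.2 (hSa p hp) h).ge
    · rw [show G (x, p.2) = t from hGb x p.2.1 p.2.2 h, ← hgb x p.2.1]
      exact (hg.g_le_iff (hSΓ p hp x) (hΓb x x p.2.1)).2 h
  let ι : closure Ω × closure Ωs × ℝ → Rn n × Rn n × ℝ := fun r => (r.1, r.2.1, r.2.2)
  have hι : Continuous ι := by fun_prop
  have hSupp : IsSupportSet Γ g Ω Ωs (ι '' S) := by
    refine ⟨hScomp.image hι, ⟨_, p₀, hp₀, rfl⟩, ?_, ?_, ?_, ?_⟩
    · rintro _ ⟨p, -, rfl⟩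
      exact p.1.2
    · rintro _ ⟨p, -, rfl⟩
      exact p.2.1.2
    · rintro _ ⟨p, hp, rfl⟩ x hx
      exact hSΓ p hp ⟨x, hx⟩
    · rintro _ ⟨p, hp, rfl⟩ _ ⟨q, hq, rfl⟩
      refine (hgG q hq p.1).trans ((hSle p hp q hq).trans_eq ?_)
      exact hGmid p.1 p.2.1 p.2.2 (hSa p hp) (hSb p hp).le
  refine ⟨ι '' S, π.map ι, hSupp, ?_, ?_, ?_, ?_, ?_⟩
  · rw [Measure.map_apply hι.measurable (hScomp.image hι).measurableSet.compl]
    exact measure_mono_null (fun r hr hmem => hr ⟨r, hmem, rfl⟩) hπ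
  · rw [← hμmap, ← hπ₁, Measure.map_map measurable_fst hι.measurable,
      Measure.map_map measurable_subtype_coe measurable_fst]
    rfl
  · rw [← hνmap, ← hπ₂, Measure.map_map measurable_subtype_coe (by fun_prop)]
    exact Measure.map_map (by fun_prop) hι.measurable
  -- Prices at or above reserve give `≤`; the triple `p₀` at its reserve price gives `≥`.
  · refine le_antisymm ?_ ?_
    · obtain ⟨_, ⟨p, hp, rfl⟩, h⟩ := hSupp.exists_eq_potential hg hx₀c
      rw [h]
      exact (hg.gstar_le_iff (hSΓ p hp ⟨x₀, hx₀c⟩) (hJ hu₀ x₀ hx₀c _ p.2.1.2)).1 (hSa p hp)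
    · have h := hSupp.le_potential hg hx₀c ⟨p₀, hp₀, rfl⟩
      have h' : g (x₀, (ι p₀).2) = u₀ := by
        simp only [ι, hp₀a]
        exact IsGeneratingFunction.g_gstar (hJ hu₀ x₀ hx₀c _ p₀.2.1.2)
      rwa [h'] at h
  · rintro _ ⟨p, hp, rfl⟩
    exact hSa p hp

/-! ### The price function and uniqueness almost everywhere -/

namespace IsSupportSet

variable {S : Set (Rn n × Rn n × ℝ)}

/-- In a support set, `z` is a Lipschitz function of `y`. -/
theorem exists_abs_sub_le (hg : IsGeneratingFunction Γ g) (hΩb : Bornology.IsBounded Ω)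
    (hS : IsSupportSet Γ g Ω Ωs S) :
    ∃ C : ℝ, 0 ≤ C ∧ ∀ p ∈ S, ∀ q ∈ S, |p.2.2 - q.2.2| ≤ C * dist p.2.1 q.2.1 := by
  have hΩc := hΩb.isCompact_closure
  let K : Set (Rn n × Rn n × ℝ) :=
    (fun r : Rn n × Rn n × Rn n × ℝ => (r.1, r.2.2)) '' closure Ω ×ˢ S
  have hKΓ : K ⊆ Γ := by
    rintro _ ⟨r, hr, rfl⟩
    exact hS.mem r.2 hr.2 r.1 hr.1
  have hK : IsCompact K := (hΩc.prod hS.isCompact).image (by fun_prop)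
  obtain ⟨δ, hδ, hδΓ⟩ := hK.exists_cthickening_subset_open hg.isOpen hKΓ
  obtain ⟨C₁, hC₁⟩ := (hK.cthickening (r := δ)).exists_bound_of_continuousOn
    (hg.continuousOn_fderiv.mono hδΓ)
  have hstep : ∀ x y y' z, (x, y, z) ∈ K → dist y y' ≤ δ →
      (x, y', z) ∈ Γ ∧ g (x, y, z) - g (x, y', z) ≤ C₁ * dist y y' := by
    intro x y y' z hxK hd
    have hball := Metric.closedBall_subset_cthickening hxK δ
    have hmem : (x, y', z) ∈ Metric.closedBall (x, y, z) δ := by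
      simpa [Metric.mem_closedBall, Prod.dist_eq, dist_comm y' y, hδ.le] using hd
    refine ⟨hδΓ (hball hmem), ?_⟩
    have h := (convex_closedBall (x, y, z) δ).norm_image_sub_le_of_norm_hasFDerivWithin_le
      (fun p hp => (hg.hasFDerivAt (hδΓ (hball hp))).hasFDerivWithinAt)
      (fun p hp => hC₁ p (hball hp)) hmem (Metric.mem_closedBall_self hδ.le)
    refine (le_abs_self _).trans (h.trans_eq ?_)
    rw [← dist_eq_norm]
    simp [Prod.dist_eq]
  -- Parametrizes the vertical segments from `(x, q.2.1, q.2.2)` up to `(x, q.2.1, p.2.2)` for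
  -- parameters at distance at most `δ`. They fill a compact subset of `Γ`, on which `-g_z` has a
  -- positive lower bound `c`.
  let T : Set (Rn n × ((Rn n × Rn n × ℝ) × Rn n × Rn n × ℝ) × ℝ) :=
    closure Ω ×ˢ (S ×ˢ S) ×ˢ Icc 0 1 ∩
      ({r | dist r.2.1.1.2.1 r.2.1.2.2.1 ≤ δ} ∩ {r | r.2.1.2.2.2 ≤ r.2.1.1.2.2})
  have hT : IsCompact T := (hΩc.prod ((hS.isCompact.prod hS.isCompact).prod isCompact_Icc)).inter_right
    ((isClosed_le (by fun_prop) (by fun_prop)).inter (isClosed_le (by fun_prop) (by fun_prop)))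
  let F : Rn n × ((Rn n × Rn n × ℝ) × Rn n × Rn n × ℝ) × ℝ → Rn n × Rn n × ℝ := fun r =>
    (r.1, r.2.1.2.2.1, r.2.1.2.2.2 + r.2.2 * (r.2.1.1.2.2 - r.2.1.2.2.2))
  have hF : Continuous F := by fun_prop
  have hFΓ : F '' T ⊆ Γ := by
    rintro _ ⟨⟨x, ⟨p, q⟩, s⟩, ⟨⟨hx, ⟨hp, hq⟩, hs⟩, hd, hz⟩, rfl⟩
    have h₁ : (x, q.2.1, q.2.2) ∈ Γ := hS.mem q hq x hx
    have h₂ : (x, q.2.1, p.2.2) ∈ Γ := (hstep x p.2.1 q.2.1 p.2.2 ⟨(x, p), ⟨hx, hp⟩, rfl⟩ hd).1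
    have hz : q.2.2 ≤ p.2.2 := hz
    have hs : 0 ≤ s ∧ s ≤ 1 := hs
    refine hg.mem_of_mem_Icc h₁ h₂ ?_ ?_ <;> simp only <;> nlinarith [hs.1, hs.2]
  have hgzc : ContinuousOn (fun p => -fderiv ℝ g p (0, 0, 1)) (F '' T) :=
    ((hg.continuousOn_fderiv.mono hFΓ).clm_apply continuousOn_const).neg
  obtain ⟨c, hc, hcle⟩ := (hT.image hF).exists_forall_le' hgzc (a := 0) fun p hp => by
    have h := hg.gz_neg p.1 p.2.1 p.2.2 (hFΓ hp)
    rw [hg.gz_eq (hFΓ hp)] at h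
    exact neg_pos.2 h
  -- With `p = (x, y, z)` and `q = (x', y', z')`: `c (z - z') ≤ g(x, y', z') - g(x, y', z) ≤ g(x, y,
  -- z) - g(x, y', z) ≤ C₁ |y - y'|`. The middle inequality is stability.
  have hnear : ∀ p ∈ S, ∀ q ∈ S, dist p.2.1 q.2.1 ≤ δ → q.2.2 ≤ p.2.2 →
      p.2.2 - q.2.2 ≤ C₁ / c * dist p.2.1 q.2.1 := by
    intro p hp q hq hd hz
    have hx := hS.fst_mem p hp
    obtain ⟨hΓ, hle⟩ := hstep p.1 p.2.1 q.2.1 p.2.2 ⟨(p.1, p), ⟨hx, hp⟩, rfl⟩ hd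
    rw [div_mul_eq_mul_div, le_div_iff₀ hc, mul_comm]
    refine le_trans ?_ hle
    have hpq : g (p.1, q.2.1, q.2.2) ≤ g (p.1, p.2.1, p.2.2) := hS.le p hp q hq
    rcases hz.eq_or_lt with heq | hlt
    · rw [heq] at hpq ⊢
      rwa [sub_self, mul_zero, sub_nonneg]
    have hI : ∀ s ∈ Icc q.2.2 p.2.2, (p.1, q.2.1, s) ∈ F '' T := by
      intro s hs
      have hpos : 0 < p.2.2 - q.2.2 := sub_pos.2 hlt
      refine ⟨(p.1, (p, q), (s - q.2.2) / (p.2.2 - q.2.2)), ⟨⟨hx, ⟨hp, hq⟩, ?_, ?_⟩, hd, hz⟩, ?_⟩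
      · exact div_nonneg (sub_nonneg.2 hs.1) hpos.le
      · exact (div_le_one hpos).2 (by linarith [hs.2])
      · simp only [F]
        rw [div_mul_cancel₀ _ hpos.ne']
        simp
    have hder : ∀ s ∈ Icc q.2.2 p.2.2, HasDerivAt (fun s => g (p.1, q.2.1, s))
        (fderiv ℝ g (p.1, q.2.1, s) (0, 0, 1)) s := fun s hs =>
      (hg.hasFDerivAt (hFΓ (hI s hs))).comp_hasDerivAt s
        ((hasDerivAt_const s p.1).prodMk ((hasDerivAt_const s q.2.1).prodMk (hasDerivAt_id s)))
    obtain ⟨s, hs, hslope⟩ := exists_hasDerivAt_eq_slope _ _ hlt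
      (fun s hs => (hder s hs).continuousAt.continuousWithinAt)
      fun s hs => hder s (Ioo_subset_Icc_self hs)
    have hcs := hcle _ (hI s (Ioo_subset_Icc_self hs))
    rw [hslope, ← neg_div, le_div_iff₀ (sub_pos.2 hlt)] at hcs
    linarith
  obtain ⟨R, hR⟩ := hS.isCompact.exists_bound_of_continuousOn
    (f := fun p : Rn n × Rn n × ℝ => p.2.2) (by fun_prop)
  -- The term `2 * R / δ` serves parameters more than `δ` apart, where boundedness of the prices
  -- suffices.
  refine ⟨max (max (C₁ / c) (2 * R / δ)) 0, le_max_right _ _, fun p hp q hq => ?_⟩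
  rcases le_or_gt (dist p.2.1 q.2.1) δ with hd | hd
  · refine le_trans ?_ (mul_le_mul_of_nonneg_right ((le_max_left (C₁ / c) (2 * R / δ)).trans
      (le_max_left _ _)) dist_nonneg)
    rcases le_total q.2.2 p.2.2 with hz | hz
    · rw [abs_of_nonneg (sub_nonneg.2 hz)]
      exact hnear p hp q hq hd hz
    · rw [abs_of_nonpos (sub_nonpos.2 hz), neg_sub, dist_comm]
      exact hnear q hq p hp (by rwa [dist_comm]) hz
  · refine le_trans ?_ (mul_le_mul_of_nonneg_right ((le_max_right (C₁ / c) (2 * R / δ)).trans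
      (le_max_left _ _)) dist_nonneg)
    have h₁ : |p.2.2| ≤ R := hR p hp
    have h₂ : |q.2.2| ≤ R := hR q hq
    have hR0 : 0 ≤ R := (abs_nonneg _).trans h₁
    calc |p.2.2 - q.2.2| ≤ |p.2.2| + |q.2.2| := abs_sub _ _
      _ ≤ 2 * R := by linarith
      _ = 2 * R / δ * δ := by field_simp
      _ ≤ 2 * R / δ * dist p.2.1 q.2.1 := by gcongr

/-- Extends the price function to the whole space, so that Rademacher's theorem applies to it. -/
theorem exists_lipschitzWith (hg : IsGeneratingFunction Γ g) (hΩb : Bornology.IsBounded Ω)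
    (hS : IsSupportSet Γ g Ω Ωs S) :
    ∃ (C : NNReal) (v : Rn n → ℝ), LipschitzWith C v ∧ ∀ p ∈ S, v p.2.1 = p.2.2 := by
  obtain ⟨C, hC, hle⟩ := hS.exists_abs_sub_le hg hΩb
  have hsel : ∀ y ∈ (fun p : Rn n × Rn n × ℝ => p.2.1) '' S, ∃ z : ℝ, ∃ p ∈ S, p.2 = (y, z) := by
    rintro _ ⟨p, hp, rfl⟩
    exact ⟨p.2.2, p, hp, rfl⟩
  choose! v hv using hsel
  have hlip : LipschitzOnWith ⟨C, hC⟩ v ((fun p : Rn n × Rn n × ℝ => p.2.1) '' S) := by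
    refine LipschitzOnWith.of_dist_le_mul fun y hy y' hy' => ?_
    obtain ⟨p, hp, hpy⟩ := hv y hy
    obtain ⟨q, hq, hqy⟩ := hv y' hy'
    have := hle p hp q hq
    rwa [hpy, hqy] at this
  obtain ⟨w, hw, heq⟩ := hlip.extend_real
  refine ⟨_, w, hw, fun p hp => ?_⟩
  have hy : p.2.1 ∈ (fun p : Rn n × Rn n × ℝ => p.2.1) '' S := ⟨p, hp, rfl⟩
  obtain ⟨q, hq, hqy⟩ := hv _ hy
  rw [← heq hy, hS.snd_unique hg hp hq (by rw [hqy]), hqy]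

/-- The supporting function with parameter `y` is unique. -/
theorem gstar_eq (hg : IsGeneratingFunction Γ g) (hS : IsSupportSet Γ g Ω Ωs S) {x₁ y : Rn n}
    {a : ℝ} (haΓ : ∀ x ∈ closure Ω, (x, y, a) ∈ Γ)
    (hx₁ : x₁ ∈ Ω) (hy : y ∈ normalMap Γ g Ω (potential g S) x₁)
    (ha : a ≤ gstar Γ g x₁ y (potential g S x₁)) {z : ℝ} {x : Rn n} (hp : (x, y, z) ∈ S) :
    gstar Γ g x₁ y (potential g S x₁) = z := by
  have hxc := hS.fst_mem _ hp
  have hx₁c : x₁ ∈ closure Ω := subset_closure hx₁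
  have hle : gstar Γ g x₁ y (potential g S x₁) ≤ z :=
    (hg.gstar_le_iff (hS.mem _ hp x₁ hx₁c) hy.1).2 (hS.le_potential hg hx₁c hp)
  refine le_antisymm hle ?_
  set z₁ := gstar Γ g x₁ y (potential g S x₁) with hz₁
  -- The normal mapping controls `(·, y, z₁)` over `Ω` only, while `x` may be a boundary point;
  -- there `a ≤ z₁ ≤ z` keeps it in `Γ`. The support inequality reaches `x` by continuity.
  have hΓ₁ : (x, y, z₁) ∈ Γ := hg.mem_of_mem_Icc (haΓ x hxc) (hS.mem _ hp x hxc) ha hle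
  have hne := mem_closure_iff_nhdsWithin_neBot.1 hxc
  have hc : ContinuousAt (fun x => g (x, y, z₁)) x :=
    (hg.continuousAt hΓ₁).comp (f := fun x' : Rn n => (x', y, z₁)) (by fun_prop)
  have hu : Tendsto (potential g S) (𝓝[Ω] x) (𝓝 (potential g S x)) :=
    (hS.continuousOn_potential hg x hxc).mono_left (nhdsWithin_mono _ subset_closure)
  have h := le_of_tendsto_of_tendsto (hc.tendsto.mono_left nhdsWithin_le_nhds) hu
    (eventually_mem_nhdsWithin.mono fun x' hx' => (hy.2 x' hx').2)
  rw [hS.potential_eq hg hp] at h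
  exact (hg.g_le_iff hΓ₁ (hS.mem _ hp x hxc)).1 h

/-- If `A1*` holds and the projection of the support set covers `Ω*`, then almost every `y ∈ Ω*`
belongs to the normal image of at most one point. -/
theorem ae_normalMap_injective (hg : IsGeneratingFunction Γ g) (hA1s : A1star Γ g)
    (hΩb : Bornology.IsBounded Ω) (hΩs : IsOpen Ωs) (hS : IsSupportSet Γ g Ω Ωs S)
    (hproj : ∀ y ∈ Ωs, ∃ p ∈ S, p.2.1 = y) {a : Rn n → ℝ}
    (haΓ : ∀ x ∈ closure Ω, ∀ y ∈ Ωs, (x, y, a y) ∈ Γ)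
    (ha : ∀ x ∈ Ω, ∀ y ∈ normalMap Γ g Ω (potential g S) x, y ∈ Ωs →
      a y ≤ gstar Γ g x y (potential g S x)) :
    ∀ᵐ y : Rn n, y ∈ Ωs → ∀ x₁ ∈ Ω, ∀ x₂ ∈ Ω, y ∈ normalMap Γ g Ω (potential g S) x₁ →
      y ∈ normalMap Γ g Ω (potential g S) x₂ → x₁ = x₂ := by
  obtain ⟨C, v, hv, hvS⟩ := hS.exists_lipschitzWith hg hΩb
  filter_upwards [hv.ae_differentiableAt (μ := volume)] with y hdiff hy
  have key : ∀ x ∈ Ω, y ∈ normalMap Γ g Ω (potential g S) x →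
      (x, y, v y) ∈ Γ ∧ ∀ e, fderiv ℝ v y e = inner ℝ (Q g x y (v y)) e := by
    intro x hx hyx
    have hxc : x ∈ closure Ω := subset_closure hx
    obtain ⟨⟨x', y', z'⟩, hp, hpy⟩ := hproj y hy
    obtain rfl : y' = y := hpy
    have hz' : v y' = z' := hvS _ hp
    have hz := hS.gstar_eq hg (fun x hx => haΓ x hx y' hy) hx hyx (ha x hx y' hyx hy) hp
    have hΓ : (x, y', v y') ∈ Γ := by
      rw [hz']
      exact hS.mem _ hp x hxc
    refine ⟨hΓ, ?_⟩
    have hval : g (x, y', v y') = potential g S x := by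
      rw [hz', ← hz]
      exact IsGeneratingFunction.g_gstar hyx.1
    -- All functions `g (·, w, v w)`, `w ∈ Ωs`, lie below the potential, and the one for `y'`
    -- touches it at `x`.
    have hmax : IsLocalMax (fun w => g (x, w, v w)) y' := by
      filter_upwards [hΩs.mem_nhds hy] with w hw
      obtain ⟨q, hq, hqw⟩ := hproj w hw
      have h1 := hS.le_potential hg hxc hq
      have h2 : q.2 = (w, v w) := by rw [← hqw, hvS q hq]
      rw [h2] at h1
      exact h1.trans_eq hval.symm
    have hder : HasFDerivAt (fun w => g (x, w, v w)) (fderiv ℝ g (x, y', v y') ∘L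
        ((0 : Rn n →L[ℝ] Rn n).prod ((ContinuousLinearMap.id ℝ (Rn n)).prod (fderiv ℝ v y')))) y' :=
      (hg.hasFDerivAt hΓ).comp (f := fun w => (x, w, v w)) y'
        ((hasFDerivAt_const x y').prodMk ((hasFDerivAt_id y').prodMk hdiff.hasFDerivAt))
    -- The first-order condition `g_y + g_z Dv = 0` says that `Dv = Q`.
    have hzero := hmax.hasFDerivAt_eq_zero hder
    intro e
    have he : fderiv ℝ g (x, y', v y') (0, e, fderiv ℝ v y' e) = 0 :=
      DFunLike.congr_fun hzero e
    have hsplit : ((0 : Rn n), e, fderiv ℝ v y' e) =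
        (0, e, 0) + fderiv ℝ v y' e • ((0 : Rn n), (0 : Rn n), (1 : ℝ)) := by simp
    rw [hsplit, map_add, map_smul, ← hg.inner_gy hΓ, ← hg.gz_eq hΓ, smul_eq_mul] at he
    have hgz := (hg.gz_neg x y' _ hΓ).ne
    rw [Q, inner_neg_left, inner_smul_left]
    simp only [map_inv₀, conj_trivial]
    field_simp
    linarith
  intro x₁ hx₁ x₂ hx₂ h₁ h₂
  obtain ⟨hΓ₁, hQ₁⟩ := key x₁ hx₁ h₁
  obtain ⟨hΓ₂, hQ₂⟩ := key x₂ hx₂ h₂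
  refine hA1s y (v y) hΓ₁ hΓ₂ (ext_inner_right ℝ fun e => ?_)
  exact (hQ₁ e).symm.trans (hQ₂ e)

end IsSupportSet

/-! ### Normalized densities and the mass balance -/

/-- The measure on `Ω` with density `f`, normalized to total mass one. -/
noncomputable def normalizedDensity (Ω : Set (Rn n)) (f : Rn n → ℝ) : Measure (Rn n) :=
  (ENNReal.ofReal (∫ x in Ω, f x))⁻¹ •
    (volume.restrict Ω).withDensity fun x => ENNReal.ofReal (f x)

section Density

variable {f : Rn n → ℝ}

theorem normalizedDensity_apply (hf : IntegrableOn f Ω)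
    (hf_pos : ∀ᵐ x ∂(volume.restrict Ω), 0 < f x) {A : Set (Rn n)} (hA : MeasurableSet A) :
    normalizedDensity Ω f A =
      (ENNReal.ofReal (∫ x in Ω, f x))⁻¹ * ENNReal.ofReal (∫ x in A ∩ Ω, f x) := by
  rw [normalizedDensity, Measure.smul_apply, smul_eq_mul, withDensity_apply _ hA,
    Measure.restrict_restrict hA, ofReal_integral_eq_lintegral_ofReal (hf.mono_set inter_subset_right)
      ((ae_restrict_of_ae_restrict_of_subset inter_subset_right hf_pos).mono fun x hx => hx.le)]

theorem isProbabilityMeasure_normalizedDensity (hΩ : IsDomainSet Ω) (hf : IntegrableOn f Ω)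
    (hf_pos : ∀ᵐ x ∂(volume.restrict Ω), 0 < f x) :
    IsProbabilityMeasure (normalizedDensity Ω f) := by
  constructor
  rw [normalizedDensity_apply hf hf_pos MeasurableSet.univ, univ_inter]
  refine ENNReal.inv_mul_cancel ?_ ENNReal.ofReal_ne_top
  exact (ENNReal.ofReal_pos.2 (setIntegral_pos_of_ae_pos subset_rfl hf hf_pos
    (hΩ.1.measure_pos volume hΩ.2.nonempty).ne')).ne'

theorem normalizedDensity_absolutelyContinuous (Ω : Set (Rn n)) (f : Rn n → ℝ) :
    normalizedDensity Ω f ≪ volume.restrict Ω :=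
  (Measure.smul_absolutelyContinuous).trans (withDensity_absolutelyContinuous _ _)

theorem normalizedDensity_compl (hΩ : IsOpen Ω) (f : Rn n → ℝ) : normalizedDensity Ω f Ωᶜ = 0 :=
  normalizedDensity_absolutelyContinuous Ω f (by
    rw [Measure.restrict_apply hΩ.measurableSet.compl]
    simp)

end Density

namespace IsSupportSet

variable {S : Set (Rn n × Rn n × ℝ)}

/-- A support set that carries a coupling with second marginal positive on the open subsets of `Ω*`
covers `Ω*`. -/
theorem exists_mem_snd_eq (hS : IsSupportSet Γ g Ω Ωs S) (hΩs : IsOpen Ωs)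
    {π : Measure (Rn n × Rn n × ℝ)} {ν : Measure (Rn n)} (hπ : π Sᶜ = 0)
    (hν : π.map (fun p => p.2.1) = ν) (hpos : ∀ W ⊆ Ωs, IsOpen W → W.Nonempty → ν W ≠ 0) :
    ∀ y ∈ Ωs, ∃ p ∈ S, p.2.1 = y := by
  intro y hy
  by_contra hcon
  have hcl : IsClosed ((fun p : Rn n × Rn n × ℝ => p.2.1) '' S) :=
    (hS.isCompact.image (by fun_prop)).isClosed
  have hopen : IsOpen (Ωs \ (fun p : Rn n × Rn n × ℝ => p.2.1) '' S) := hΩs.sdiff hcl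
  refine hpos _ sdiff_subset hopen ⟨y, hy, hcon⟩ ?_
  rw [← hν, Measure.map_apply (by fun_prop) hopen.measurableSet]
  exact measure_mono_null (fun p hp hpS => hp.2 ⟨p, hpS, rfl⟩) hπ

/-- The normal mapping of the potential in terms of the function `v` whose graph is the projection
of the support set. -/
theorem mem_normalMap_iff (hg : IsGeneratingFunction Γ g) (hS : IsSupportSet Γ g Ω Ωs S) {x y : Rn n}
    {a : ℝ} (haΓ : ∀ x ∈ closure Ω, (x, y, a) ∈ Γ) (hx : x ∈ Ω)
    (ha : y ∈ normalMap Γ g Ω (potential g S) x → a ≤ gstar Γ g x y (potential g S x))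
    {p : Rn n × Rn n × ℝ} (hp : p ∈ S) (hpy : p.2.1 = y) :
    y ∈ normalMap Γ g Ω (potential g S) x ↔ g (x, y, p.2.2) = potential g S x := by
  obtain ⟨x', y', z'⟩ := p
  obtain rfl : y' = y := hpy
  have hΓ := hS.mem _ hp x (subset_closure hx)
  constructor
  · intro h
    rw [← hS.gstar_eq hg haΓ hx h (ha h) hp, IsGeneratingFunction.g_gstar h.1]
  · intro h
    refine ⟨⟨z', hΓ, h⟩, fun w hw => ?_⟩
    rw [← h, hg.gstar_g hΓ]
    exact ⟨hS.mem _ hp w (subset_closure hw), hS.le_potential hg (subset_closure hw) hp⟩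

/-- By `mem_normalMap_iff` the graph over `Ω ×ˢ Ωs` is the zero set of a continuous function on an
open set. -/
theorem measurableSet_graph_normalMap (hg : IsGeneratingFunction Γ g) (hΩ : IsOpen Ω)
    (hΩb : Bornology.IsBounded Ω) (hΩs : IsOpen Ωs)
    (hS : IsSupportSet Γ g Ω Ωs S) (hproj : ∀ y ∈ Ωs, ∃ p ∈ S, p.2.1 = y) {a : Rn n → ℝ}
    (haΓ : ∀ x ∈ closure Ω, ∀ y ∈ Ωs, (x, y, a y) ∈ Γ)
    (ha : ∀ x ∈ Ω, ∀ y ∈ normalMap Γ g Ω (potential g S) x, y ∈ Ωs →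
      a y ≤ gstar Γ g x y (potential g S x)) :
    MeasurableSet {q : Rn n × Rn n | q.1 ∈ Ω ∧ q.2 ∈ Ωs ∧
      q.2 ∈ normalMap Γ g Ω (potential g S) q.1} := by
  obtain ⟨C, v, hv, hvS⟩ := hS.exists_lipschitzWith hg hΩb
  have hcont : ContinuousOn (fun q : Rn n × Rn n => g (q.1, q.2, v q.2) - potential g S q.1)
      (Ω ×ˢ Ωs) := by
    have hvc := hv.continuous
    refine ContinuousOn.sub (hg.continuousOn.comp (f := fun q : Rn n × Rn n => (q.1, q.2, v q.2))
      (by fun_prop) fun q hq => ?_) (((hS.continuousOn_potential hg).mono subset_closure).comp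
      continuousOn_fst fun q hq => hq.1)
    obtain ⟨p, hp, hpy⟩ := hproj q.2 hq.2
    have h := hS.mem p hp q.1 (subset_closure hq.1)
    rwa [show p.2 = (q.2, v q.2) by rw [← hpy, hvS p hp]] at h
  have hopen := hΩ.prod hΩs
  have heq : {q : Rn n × Rn n | q.1 ∈ Ω ∧ q.2 ∈ Ωs ∧ q.2 ∈ normalMap Γ g Ω (potential g S) q.1} =
      (Ω ×ˢ Ωs) \ ((Ω ×ˢ Ωs) ∩
        (fun q : Rn n × Rn n => g (q.1, q.2, v q.2) - potential g S q.1) ⁻¹' {0}ᶜ) := by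
    ext ⟨x, y⟩
    simp only [mem_ofPred_eq, Set.mem_sdiff, mem_prod, mem_inter_iff, mem_preimage, mem_compl_iff,
      mem_singleton_iff, sub_eq_zero]
    constructor
    · rintro ⟨hx, hy, h⟩
      obtain ⟨p, hp, hpy⟩ := hproj y hy
      have h1 := (hS.mem_normalMap_iff hg (fun x hx => haΓ x hx y hy) hx
        (fun h => ha x hx y h hy) hp hpy).1 h
      rw [← hvS p hp, hpy] at h1
      exact ⟨⟨hx, hy⟩, fun hc => hc.2 h1⟩
    · rintro ⟨⟨hx, hy⟩, h⟩
      obtain ⟨p, hp, hpy⟩ := hproj y hy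
      refine ⟨hx, hy, (hS.mem_normalMap_iff hg (fun x hx => haΓ x hx y hy) hx
        (fun h => ha x hx y h hy) hp hpy).2 ?_⟩
      rw [← hvS p hp, hpy]
      by_contra hne
      exact h ⟨⟨hx, hy⟩, hne⟩
  rw [heq]
  exact MeasurableSet.diff hopen.measurableSet
    (hcont.isOpen_inter_preimage hopen isClosed_singleton.isOpen_compl).measurableSet

/-- The image of a Borel set under the normal mapping of the potential agrees almost everywhere in
`Ω*` with a Borel set of the same mass. -/
theorem exists_measurableSet_ae_eq (hg : IsGeneratingFunction Γ g) (hA1s : A1star Γ g)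
    (hΩ : IsOpen Ω) (hΩb : Bornology.IsBounded Ω) (hΩs : IsOpen Ωs)
    (hS : IsSupportSet Γ g Ω Ωs S) (hproj : ∀ y ∈ Ωs, ∃ p ∈ S, p.2.1 = y) {a : Rn n → ℝ}
    (haΓ : ∀ x ∈ closure Ω, ∀ y ∈ Ωs, (x, y, a y) ∈ Γ)
    (ha : ∀ x ∈ Ω, ∀ y ∈ normalMap Γ g Ω (potential g S) x, y ∈ Ωs →
      a y ≤ gstar Γ g x y (potential g S x))
    {π : Measure (Rn n × Rn n × ℝ)} {μ ν : Measure (Rn n)} (hπ : π Sᶜ = 0)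
    (hμ : π.map (fun p => p.1) = μ) (hν : π.map (fun p => p.2.1) = ν) (hμΩ : μ Ωᶜ = 0)
    (hνΩs : ν Ωsᶜ = 0) (hνac : ν ≪ volume) {A : Set (Rn n)} (hA : MeasurableSet A) (hAΩ : A ⊆ Ω) :
    ∃ B ⊆ Ωs, MeasurableSet B ∧
      (normalImage Γ g Ω (potential g S) A ∩ Ωs : Set (Rn n)) =ᵐ[volume] B ∧ ν B = μ A := by
  have hinj := hS.ae_normalMap_injective hg hA1s hΩb hΩs hproj haΓ ha
  rw [ae_iff] at hinj
  set D := {y : Rn n | ¬(y ∈ Ωs → ∀ x₁ ∈ Ω, ∀ x₂ ∈ Ω, y ∈ normalMap Γ g Ω (potential g S) x₁ →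
      y ∈ normalMap Γ g Ω (potential g S) x₂ → x₁ = x₂)}
  have huniq : ∀ y ∈ Ωs, y ∉ toMeasurable volume D → ∀ x₁ ∈ Ω, ∀ x₂ ∈ Ω,
      y ∈ normalMap Γ g Ω (potential g S) x₁ → y ∈ normalMap Γ g Ω (potential g S) x₂ → x₁ = x₂ := by
    intro y hy hyD
    have h : y ∉ D := fun h => hyD (subset_toMeasurable _ _ h)
    exact not_not.1 h hy
  -- A Borel null set containing the exceptional parameters; removing it keeps `R` Borel.
  set N := toMeasurable volume D with hN
  have hNm : MeasurableSet N := measurableSet_toMeasurable _ _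
  have hN0 : volume N = 0 := by rw [hN, measure_toMeasurable, hinj]
  let R : Set (Rn n × Rn n) :=
    {q | q.1 ∈ Ω ∧ q.2 ∈ Ωs ∧ q.2 ∈ normalMap Γ g Ω (potential g S) q.1} ∩ (A ×ˢ Nᶜ)
  have hR : MeasurableSet R :=
    (hS.measurableSet_graph_normalMap hg hΩ hΩb hΩs hproj haΓ ha).inter (hA.prod hNm.compl)
  have hRinj : InjOn Prod.snd R := by
    rintro ⟨x₁, y₁⟩ h₁ ⟨x₂, y₂⟩ h₂ h
    obtain rfl : y₁ = y₂ := h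
    exact Prod.ext (huniq y₁ h₁.1.2.1 h₁.2.2 x₁ h₁.1.1 x₂ h₂.1.1 h₁.1.2.2 h₂.1.2.2) rfl
  -- Lusin–Souslin: the injective image of a Borel set is Borel.
  have hB : MeasurableSet (Prod.snd '' R) := hR.image_of_measurable_injOn measurable_snd hRinj
  refine ⟨Prod.snd '' R, ?_, hB, ?_, ?_⟩
  · rintro _ ⟨q, hq, rfl⟩
    exact hq.1.2.1
  · have hae : ∀ᵐ y : Rn n, y ∉ N := measure_eq_zero_iff_ae_notMem.1 hN0
    filter_upwards [hae] with y hyN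
    refine propext ⟨fun hy => ?_, ?_⟩
    · have hy : y ∈ normalImage Γ g Ω (potential g S) A ∩ Ωs := hy
      obtain ⟨x, hx, hyx⟩ := mem_iUnion₂.1 hy.1
      exact ⟨(x, y), ⟨⟨hAΩ hx, hy.2, hyx⟩, hx, hyN⟩, rfl⟩
    · rintro ⟨q, hq, rfl⟩
      exact ⟨mem_iUnion₂.2 ⟨q.1, hq.2.1, hq.1.2.2⟩, hq.1.2.1⟩
  · rw [← hμ, ← hν, Measure.map_apply (by fun_prop) hB, Measure.map_apply measurable_fst hA]
    have h₁ : ∀ᵐ p ∂π, p.1 ∈ Ω := by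
      have h : π ((fun p => p.1) ⁻¹' Ωᶜ) = 0 := by
        rw [← Measure.map_apply measurable_fst hΩ.measurableSet.compl, hμ, hμΩ]
      exact h
    have h₂ : ∀ᵐ p ∂π, p.2.1 ∈ Ωs \ N := by
      have h : π ((fun p => p.2.1) ⁻¹' (Ωs \ N)ᶜ) = 0 := by
        rw [← Measure.map_apply (by fun_prop) (MeasurableSet.diff hΩs.measurableSet hNm).compl,
          hν, Set.compl_sdiff]
        exact measure_union_null (hνac hN0) hνΩs
      exact h
    have h₃ : ∀ᵐ p ∂π, p ∈ S := hπ
    -- For almost every triple, uniqueness turns `p.2.1 ∈ Prod.snd '' R` into `p.1 ∈ A`.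
    refine measure_congr ?_
    filter_upwards [h₁, h₂, h₃] with p hp₁ hp₂ hp₃
    have hp : p.2.1 ∈ normalMap Γ g Ω (potential g S) p.1 := hS.mem_normalMap hg hp₃
    refine propext ⟨?_, fun hpA => ?_⟩
    · rintro ⟨⟨x, y⟩, hq, hqy⟩
      obtain rfl : y = p.2.1 := hqy
      have hx : x = p.1 := huniq _ hp₂.1 hp₂.2 x hq.1.1 p.1 hp₁ hq.1.2.2 hp
      have hxA : x ∈ A := hq.2.1
      rwa [hx] at hxA
    · exact ⟨(p.1, p.2.1), ⟨⟨hp₁, hp₂.1, hp⟩, hpA, hp₂.2⟩, rfl⟩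

end IsSupportSet

/-! ### The generalized solution and the theorem -/

/-- Existence of a generalized solution with prescribed value at a point. -/
theorem exists_isGeneralizedSolution {U V : Set (Rn n)} (hg : IsGeneratingFunction Γ g)
    (hA1s : A1star Γ g) (hUV : IsAdmissiblePair Γ g U V)
    (hΩ : IsDomainSet Ω) (hΩb : Bornology.IsBounded Ω) (hΩU : closure Ω ⊆ U)
    (hΩs : IsDomainSet Ωs) (hΩsb : Bornology.IsBounded Ωs) (hΩsV : closure Ωs ⊆ V)
    {m₀ M₀ : EReal} {K₀ : ℝ} (hA5 : A5 Γ g U V Ω Ωs m₀ M₀ K₀) {f fs : Rn n → ℝ}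
    (hf : IntegrableOn f Ω) (hf_pos : ∀ᵐ x ∂(volume.restrict Ω), 0 < f x)
    (hfs : IntegrableOn fs Ωs) (hfs_pos : ∀ᵐ y ∂(volume.restrict Ωs), 0 < fs y)
    (hmass : ∫ x in Ω, f x = ∫ y in Ωs, fs y) {x₀ : Rn n} (hx₀ : x₀ ∈ Ω) {u₀ : ℝ}
    (hu₀ : u₀ ∈ JInter Γ g U V) (hlt : m₀ + K1 K₀ Ω < (u₀ : EReal)) :
    ∃ u : Rn n → ℝ, IsGeneralizedSolution Γ g Ω Ωs f fs u ∧ u x₀ = u₀ := by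
  obtain ⟨t, ht, hlevel⟩ := hA5.exists_level hg hUV hΩb hΩU hΩsb hΩsV hx₀ hu₀ hlt
  have hPμ := isProbabilityMeasure_normalizedDensity hΩ hf hf_pos
  have hPν := isProbabilityMeasure_normalizedDensity hΩs hfs hfs_pos
  have hμΩ := normalizedDensity_compl hΩ.1 f
  have hνΩs := normalizedDensity_compl hΩs.1 fs
  obtain ⟨S, π, hS, hπ, hπμ, hπν, hval, hSa⟩ := exists_isSupportSet hg hUV hΩb hΩU hΩsb hΩsV hx₀ hu₀
    (hA5.subset ht) hlevel (normalizedDensity Ω f) (normalizedDensity Ωs fs)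
    (measure_mono_null (compl_subset_compl.2 subset_closure) hμΩ)
    (measure_mono_null (compl_subset_compl.2 subset_closure) hνΩs)
  have hmpos : 0 < ∫ x in Ω, f x := setIntegral_pos_of_ae_pos subset_rfl hf hf_pos
    (hΩ.1.measure_pos volume hΩ.2.nonempty).ne'
  have hinv : (ENNReal.ofReal (∫ x in Ω, f x))⁻¹ ≠ 0 := ENNReal.inv_ne_zero.2 ENNReal.ofReal_ne_top
  have hinv' : (ENNReal.ofReal (∫ x in Ω, f x))⁻¹ ≠ ⊤ :=
    ENNReal.inv_ne_top.2 (ENNReal.ofReal_pos.2 hmpos).ne'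
  have hproj := hS.exists_mem_snd_eq hΩs.1 hπ hπν fun W hW hWo hWne => by
    rw [normalizedDensity_apply hfs hfs_pos hWo.measurableSet, inter_eq_left.2 hW, ← hmass]
    exact mul_ne_zero hinv (ENNReal.ofReal_pos.2 (setIntegral_pos_of_ae_pos hW hfs hfs_pos
      (hWo.measure_pos volume hWne).ne')).ne'
  have haΓ : ∀ x ∈ closure Ω, ∀ y ∈ Ωs, (x, y, gstar Γ g x₀ y u₀) ∈ Γ := fun x hx y hy =>
    hUV.2.2 x (hΩU hx) y (hΩsV (subset_closure hy)) x₀ (hΩU (subset_closure hx₀)) y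
      (hΩsV (subset_closure hy)) u₀ hu₀
  -- A supporting function lies below `u₀` at `x₀`, so its price is at least the reserve price.
  have ha : ∀ x ∈ Ω, ∀ y ∈ normalMap Γ g Ω (potential g S) x, y ∈ Ωs →
      gstar Γ g x₀ y u₀ ≤ gstar Γ g x y (potential g S x) := fun x hx y hy hys => by
    obtain ⟨hΓ, hle⟩ := hy.2 x₀ hx₀
    rw [hval] at hle
    exact (hg.gstar_le_iff hΓ (mem_J_of_mem_JInter hu₀ (hΩU (subset_closure hx₀))
      (hΩsV (subset_closure hys)))).2 hle
  refine ⟨potential g S, ⟨hS.continuousOn_potential hg, hS.isGConvex_potential hg, ?_⟩, hval⟩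
  intro A hA hAΩ
  obtain ⟨B, hBΩs, hB, hAB, hmeas⟩ := hS.exists_measurableSet_ae_eq hg hA1s hΩ.1 hΩb hΩs.1 hproj haΓ ha
    hπ hπμ hπν hμΩ hνΩs ((normalizedDensity_absolutelyContinuous Ωs fs).trans
      Measure.restrict_le_self.absolutelyContinuous) hA hAΩ
  refine ⟨hB.nullMeasurableSet.congr hAB.symm, ?_⟩
  rw [normalizedDensity_apply hfs hfs_pos hB, normalizedDensity_apply hf hf_pos hA, ← hmass,
    inter_eq_left.2 hBΩs, inter_eq_left.2 hAΩ, ENNReal.mul_right_inj hinv hinv'] at hmeas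
  rw [setIntegral_congr_set hAB]
  refine (ENNReal.ofReal_eq_ofReal_iff ?_ ?_).1 hmeas
  · exact integral_nonneg_of_ae
      ((ae_restrict_of_ae_restrict_of_subset hBΩs hfs_pos).mono fun x hx => hx.le)
  · exact integral_nonneg_of_ae
      ((ae_restrict_of_ae_restrict_of_subset hAΩ hf_pos).mono fun x hx => hx.le)

end GJE

theorem theorem3p1 {n : ℕ} (Γ : Set (GJE.Rn n × GJE.Rn n × ℝ))
    (g : GJE.Rn n × GJE.Rn n × ℝ → ℝ) (U V Ω Ωs : Set (GJE.Rn n))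
    (hg : GJE.IsGeneratingFunction Γ g)
    (hA1 : GJE.A1 Γ g) (hA2 : GJE.A2 Γ g) (hA1s : GJE.A1star Γ g)
    (hUV : GJE.IsAdmissiblePair Γ g U V)
    (hΩ : GJE.IsDomainSet Ω) (hΩb : Bornology.IsBounded Ω) (hΩU : closure Ω ⊆ U)
    (hΩs : GJE.IsDomainSet Ωs) (hΩsb : Bornology.IsBounded Ωs) (hΩsV : closure Ωs ⊆ V)
    (m₀ M₀ : EReal) (K₀ : ℝ) (hA5 : GJE.A5 Γ g U V Ω Ωs m₀ M₀ K₀)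
    (f fs : GJE.Rn n → ℝ)
    (hf : IntegrableOn f Ω) (hf_pos : ∀ᵐ x ∂(volume.restrict Ω), 0 < f x)
    (hfs : IntegrableOn fs Ωs) (hfs_pos : ∀ᵐ y ∂(volume.restrict Ωs), 0 < fs y)
    (hmass : ∫ x in Ω, f x = ∫ y in Ωs, fs y) :
    (∀ x₀ ∈ Ω, ∀ u₀ : ℝ, u₀ ∈ GJE.JInter Γ g U V → m₀ + GJE.K1 K₀ Ω < (u₀ : EReal) →
      ∃ u : GJE.Rn n → ℝ, GJE.IsGeneralizedSolution Γ g Ω Ωs f fs u ∧ u x₀ = u₀) ∧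
    (∀ u : GJE.Rn n → ℝ, GJE.IsGeneralizedSolution Γ g Ω Ωs f fs u →
      (∀ x ∈ Ω, u x ∈ GJE.JInter Γ g {x} (closure Ωs)) →
      GJE.IsGStarConvexWrt Γ g Ω Ωs u →
      GJE.normalImage Γ g Ω u Ω ⊆ closure Ωs) :=
  ⟨fun _ hx₀ _ hu₀ hlt => GJE.exists_isGeneralizedSolution hg hA1s hUV hΩ hΩb hΩU hΩs hΩsb hΩsV hA5 hf
    hf_pos hfs hfs_pos hmass hx₀ hu₀ hlt,
  fun _ hu huJ hconv => hu.normalImage_subset hg hA1 hΩ.1 hΩsb hf hf_pos huJ hconv⟩
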